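/- Consider the following scheduling problem on a single processor. An instance consists of tasks $v_1,\dots,v_n$ with running times $\omega_1,\dots,\omega_n$, a horizon $[0,T)$ divided into $J$ consecutive intervals $I_1,\dots,I_J$ of lengths $\ell_1,\dots,\ell_J$, so that $T=\sum_j \ell_j$ is the deadline, a green power budget $\mathcal G_j$ for each interval $I_j$, and an idle power $P_{\mathrm{idle}}$ and a working power $P_{\mathrm{work}}$ of the processor; all these are nonnegative integers. A schedule is a choice of integer start times $\sigma_1,\dots,\sigma_n\ge 0$; it is feasible if $\sigma_i+\omega_i\le\sigma_j$ for all $i<j$ (the tasks are executed in the given order) and $\sigma_i+\omega_i\le T$ for all $i$. The power $\mathcal P_t$ consumed in the time unit $t$ is $P_{\mathrm{idle}}+P_{\mathrm{work}}$ if $\sigma_i\le t<\sigma_i+\omega_i$ for some $i$, and $P_{\mathrm{idle}}$ otherwise. The total carbon cost of the schedule is $\sum_{j=1}^{J}\sum_{t\in I_j}\max(\mathcal P_t-\mathcal G_j,0)$, where $t$ ranges over integers. A feasible schedule is optimal if its total carbon cost is minimum among all feasible schedules. Theorem. There is an algorithm which, given any such instance, decides whether a feasible schedule exists and, if so, computes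 an optimal schedule, in time polynomial in the bit length of the instance (all numbers being written in binary). Here time is the logarithmic cost on a random-access machine. -/

import Mathlib

/-! ## A random-access machine with logarithmic cost -/

namespace Ram

/-- Programs of a random-access machine, in structured form. A program addresses finitely many
registers by constant indices, and an unbounded memory through addresses held in registers. All
cells hold natural numbers of arbitrary size. -/
inductive Prog where
  /-- `reg d := c` -/
  | const (d c : ℕ)
  /-- `reg d := reg a + reg b` -/
  | add (d a b : ℕ)
  /-- `reg d := max (reg a - reg b) 0` -/
  | sub (d a b : ℕ)
  /-- `reg d := reg a * reg b` -/
  | mul (d a b : ℕ)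
  /-- `reg d := mem (reg a)` -/
  | load (d a : ℕ)
  /-- `mem (reg a) := reg b` -/
  | store (a b : ℕ)
  /-- first `p`, then `q` -/
  | seq (p q : Prog)
  /-- if `reg r ≠ 0` then `p` else `q` -/
  | cond (r : ℕ) (p q : Prog)
  /-- while `reg r ≠ 0` do `p` -/
  | loop (r : ℕ) (p : Prog)

/-- The contents of the registers and of the memory. -/
structure State where
  reg : ℕ → ℕ
  mem : ℕ → ℕ

/-- Write `v` into register `d`. -/
def State.setReg (s : State) (d v : ℕ) : State :=
  { s with reg := Function.update s.reg d v }

/-- Write `v` into the memory cell with address `x`. -/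
def State.setMem (s : State) (x v : ℕ) : State :=
  { s with mem := Function.update s.mem x v }

/-- The initial state: the input word by word in the memory cells `0, 1, 2, …`, and `0` in every
other cell and in every register. -/
def State.init (input : List ℕ) : State where
  reg _ := 0
  mem x := input.getD x 0

/-- `Exec p s s' c`: the program `p`, started in `s`, halts in `s'` at logarithmic cost `c`. Every
elementary operation and every test costs one unit plus the number of bits of the numbers it
works on, which for a memory access are the address and the transferred content. -/
inductive Exec : Prog → State → State → ℕ → Prop where
  | const (s : State) (d c : ℕ) :
      Exec (.const d c) s (s.setReg d c) (1 + c.size)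
  | add (s : State) (d a b : ℕ) :
      Exec (.add d a b) s (s.setReg d (s.reg a + s.reg b))
        (1 + (s.reg a).size + (s.reg b).size)
  | sub (s : State) (d a b : ℕ) :
      Exec (.sub d a b) s (s.setReg d (s.reg a - s.reg b))
        (1 + (s.reg a).size + (s.reg b).size)
  | mul (s : State) (d a b : ℕ) :
      Exec (.mul d a b) s (s.setReg d (s.reg a * s.reg b))
        (1 + (s.reg a).size + (s.reg b).size)
  | load (s : State) (d a : ℕ) :
      Exec (.load d a) s (s.setReg d (s.mem (s.reg a)))
        (1 + (s.reg a).size + (s.mem (s.reg a)).size)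
  | store (s : State) (a b : ℕ) :
      Exec (.store a b) s (s.setMem (s.reg a) (s.reg b))
        (1 + (s.reg a).size + (s.reg b).size)
  | seq {p q : Prog} {s s₁ s₂ : State} {c₁ c₂ : ℕ} :
      Exec p s s₁ c₁ → Exec q s₁ s₂ c₂ → Exec (.seq p q) s s₂ (c₁ + c₂)
  | cond_true {r : ℕ} {p q : Prog} {s s' : State} {c : ℕ} :
      s.reg r ≠ 0 → Exec p s s' c → Exec (.cond r p q) s s' (1 + (s.reg r).size + c)
  | cond_false {r : ℕ} {p q : Prog} {s s' : State} {c : ℕ} :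
      s.reg r = 0 → Exec q s s' c → Exec (.cond r p q) s s' (1 + c)
  | loop_step {r : ℕ} {p : Prog} {s s₁ s₂ : State} {c₁ c₂ : ℕ} :
      s.reg r ≠ 0 → Exec p s s₁ c₁ → Exec (.loop r p) s₁ s₂ c₂ →
        Exec (.loop r p) s s₂ (1 + (s.reg r).size + c₁ + c₂)
  | loop_done {r : ℕ} {p : Prog} {s : State} :
      s.reg r = 0 → Exec (.loop r p) s s 1

/-- The bit length of an input: each number is written in binary and followed by a delimiter. -/
def bitLength (input : List ℕ) : ℕ :=
  (input.map fun x => x.size + 1).sum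

/-- A search problem, with instances `α` given to the machine as lists of natural numbers through
`encode`, and `Correct x out` saying that the memory content `out` is a correct answer to the
instance `x`, is solvable in polynomial time: one program halts on every instance with a correct
answer, at a cost polynomial in the bit length of the instance. -/
def SolvableInPolyTime {α : Type} (encode : α → List ℕ) (Correct : α → (ℕ → ℕ) → Prop) : Prop :=
  ∃ (p : Prog) (q : Polynomial ℕ), ∀ x : α, ∃ (s : State) (c : ℕ),
    Exec p (State.init (encode x)) s c ∧ c ≤ q.eval (bitLength (encode x)) ∧ Correct x s.mem

end Ram

/-! ## Carbon-cost minimisation on a single processor -/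

/-- An instance with a single processor: `n` tasks, to be executed in the order of their indices,
and a horizon divided into `J` consecutive intervals. -/
structure CarbonInstance where
  /-- number of tasks -/
  n : ℕ
  /-- number of intervals -/
  J : ℕ
  /-- idle power of the processor -/
  idle : ℕ
  /-- power added while the processor is active -/
  work : ℕ
  /-- running times of the tasks -/
  dur : Fin n → ℕ
  /-- lengths of the intervals -/
  len : Fin J → ℕ
  /-- green power budget, per time unit, of each interval -/
  green : Fin J → ℕ

namespace CarbonInstance

variable (I : CarbonInstance)

/-- The deadline: the horizon is `[0, T)`. -/
def T : ℕ := ∑ j, I.len j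

/-- The beginning `b_j` of the `j`-th interval `[b_j, e_j)`. -/
def b (j : Fin I.J) : ℕ := ∑ k ∈ Finset.Iio j, I.len k

/-- The end `e_j` of the `j`-th interval `[b_j, e_j)`. -/
def e (j : Fin I.J) : ℕ := I.b j + I.len j

/-- A schedule assigns a start time to each task. It is feasible if no task starts before the
tasks that precede it in the order are completed, and every task is completed by the deadline. -/
def Feasible (σ : Fin I.n → ℕ) : Prop :=
  (∀ i j, i < j → σ i + I.dur i ≤ σ j) ∧ ∀ i, σ i + I.dur i ≤ I.T

/-- The processor executes some task during the time unit `t`. -/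
def Active (σ : Fin I.n → ℕ) (t : ℕ) : Prop :=
  ∃ i, σ i ≤ t ∧ t < σ i + I.dur i

open Classical in
/-- The power consumed in the time unit `t`. -/
noncomputable def power (σ : Fin I.n → ℕ) (t : ℕ) : ℕ :=
  I.idle + if I.Active σ t then I.work else 0

/-- The total carbon cost: the power in excess of the green budget, summed over all time units of
all intervals. The subtraction of natural numbers is `max (power - green) 0`. -/
noncomputable def cost (σ : Fin I.n → ℕ) : ℕ :=
  ∑ j, ∑ t ∈ Finset.Ico (I.b j) (I.e j), (I.power σ t - I.green j)

/-- A feasible schedule of minimum total carbon cost. -/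
def Optimal (σ : Fin I.n → ℕ) : Prop :=
  I.Feasible σ ∧ ∀ τ, I.Feasible τ → I.cost σ ≤ I.cost τ

/-- An instance as a list of numbers: the four scalar parameters, then the running times, the
interval lengths and the green budgets. -/
def encode : List ℕ :=
  [I.n, I.J, I.idle, I.work] ++ List.ofFn I.dur ++ List.ofFn I.len ++ List.ofFn I.green

/-- Correct answers: `0` in cell `0` if there is no feasible schedule, and otherwise `1` in cell
`0` and the start times of an optimal schedule in the cells `1, …, n`. -/
def CorrectAnswer (out : ℕ → ℕ) : Prop :=
  ((∃ σ, I.Feasible σ) → out 0 = 1 ∧ I.Optimal fun i => out (i.val + 1)) ∧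
    ((¬ ∃ σ, I.Feasible σ) → out 0 = 0)

end CarbonInstance

/-! Let `rest k` be the total running time of the tasks from `k` on, and describe a schedule by x_k
= σ_k + `rest k`, the time at which all work would end if the tasks from `k` on ran without pause.
In these coordinates feasibility says exactly that x is nondecreasing with values between the total
running time and T (`feasible_sub_rest`, `Feasible.add_rest`). As tasks never overlap, the cost is a
constant plus a sum of functions `taskCost k` of the single x_k (`cost_eq`). Each of them is
piecewise affine, with kinks only where the start or the end of task `k` meets an interval boundary,
that is, where x_k is a boundary plus `rest k` or `rest (k + 1)` (`affineOnIcc_taskCost`). Hence all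
tasks share one set of at most (J + 1)(n + 1) breakpoints.

An optimal x can be sought among the breakpoints (`exists_rounding`). Round every x_k to one of its
two neighbouring breakpoints, upwards with probability equal to its relative position in the gap,
using one random threshold common to all k. The common threshold keeps the sequence monotone, and by
affinity the expected cost is the old cost, so some threshold does not increase it. A cheapest
monotone sequence in a set of polynomial size is found by dynamic programming
(`MonotoneDP.sum_path_le`), and together this gives `optimal_startTime`.

For the running time, the algorithm is written in a small language with bounded loops and compiled
to the machine (`exists_prog`). If all numbers formed stay below 2 ^ B, each elementary step costs
at most 1 + 2B, so it is enough to count steps and to bound numbers. The bounds are B = 4L and at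
most L ^ 2 rounds per loop, where L is the bit length (`sizeBound_lt`, `numCand_le`). -/

/-! ## A structured language with expressions and bounded loops -/

namespace Ram

/-- The values of the variables and the contents of the memory. -/
structure Store (ι : Type) where
  var : ι → ℕ
  mem : ℕ → ℕ

namespace Store

variable {ι : Type}

/-- Write `v` into the variable `x`. -/
def setVar [DecidableEq ι] (s : Store ι) (x : ι) (v : ℕ) : Store ι :=
  { s with var := Function.update s.var x v }

/-- Write `v` into the memory cell with address `a`. -/
def setMem (s : Store ι) (a v : ℕ) : Store ι :=
  { s with mem := Function.update s.mem a v }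

/-- The initial store: the input in the memory, and `0` everywhere else. -/
def init (input : List ℕ) : Store ι where
  var _ := 0
  mem a := input.getD a 0

@[simp] lemma setVar_mem [DecidableEq ι] (s : Store ι) (x : ι) (v : ℕ) :
    (s.setVar x v).mem = s.mem := rfl

@[simp] lemma setVar_var_self [DecidableEq ι] (s : Store ι) (x : ι) (v : ℕ) :
    (s.setVar x v).var x = v := by simp [setVar]

lemma setVar_var_of_ne [DecidableEq ι] (s : Store ι) {x y : ι} (h : y ≠ x) (v : ℕ) :
    (s.setVar x v).var y = s.var y := by simp [setVar, h]

@[simp] lemma setMem_var (s : Store ι) (a v : ℕ) : (s.setMem a v).var = s.var := rfl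

@[simp] lemma setMem_mem (s : Store ι) (a v : ℕ) :
    (s.setMem a v).mem = Function.update s.mem a v := rfl

end Store

/-- Arithmetic expressions in variables and memory cells. -/
inductive Expr (ι : Type) where
  | const (c : ℕ)
  | var (x : ι)
  | add (a b : Expr ι)
  | sub (a b : Expr ι)
  | mul (a b : Expr ι)
  | load (a : Expr ι)

namespace Expr

variable {ι : Type}

instance : Add (Expr ι) := ⟨add⟩
instance : Sub (Expr ι) := ⟨sub⟩
instance : Mul (Expr ι) := ⟨mul⟩
instance (c : ℕ) : OfNat (Expr ι) c := ⟨const c⟩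

/-- The value of an expression. -/
def eval (s : Store ι) : Expr ι → ℕ
  | const c => c
  | var x => s.var x
  | add a b => a.eval s + b.eval s
  | sub a b => a.eval s - b.eval s
  | mul a b => a.eval s * b.eval s
  | load a => s.mem (a.eval s)

/-- All constants, sums and products that occur in the evaluation are less than `V`. -/
def Safe (V : ℕ) (s : Store ι) : Expr ι → Prop
  | const c => c < V
  | var _ => True
  | add a b => a.Safe V s ∧ b.Safe V s ∧ a.eval s + b.eval s < V
  | sub a b => a.Safe V s ∧ b.Safe V s
  | mul a b => a.Safe V s ∧ b.Safe V s ∧ a.eval s * b.eval s < V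
  | load a => a.Safe V s

section
variable (s : Store ι) (V : ℕ) (a b : Expr ι) (x : ι) (c : ℕ)

@[simp] lemma eval_ofNat : (no_index (OfNat.ofNat c : Expr ι)).eval s = OfNat.ofNat c := rfl
@[simp] lemma eval_var : (var x).eval s = s.var x := rfl
@[simp] lemma eval_add : (a + b).eval s = a.eval s + b.eval s := rfl
@[simp] lemma eval_sub : (a - b).eval s = a.eval s - b.eval s := rfl
@[simp] lemma eval_mul : (a * b).eval s = a.eval s * b.eval s := rfl
@[simp] lemma eval_load : (load a).eval s = s.mem (a.eval s) := rfl

@[simp] lemma safe_ofNat :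
    (no_index (OfNat.ofNat c : Expr ι)).Safe V s ↔ OfNat.ofNat c < V := Iff.rfl
@[simp] lemma safe_var : (var x).Safe V s := trivial
@[simp] lemma safe_add :
    (a + b).Safe V s ↔ a.Safe V s ∧ b.Safe V s ∧ a.eval s + b.eval s < V := Iff.rfl
@[simp] lemma safe_sub : (a - b).Safe V s ↔ a.Safe V s ∧ b.Safe V s := Iff.rfl
@[simp] lemma safe_mul :
    (a * b).Safe V s ↔ a.Safe V s ∧ b.Safe V s ∧ a.eval s * b.eval s < V := Iff.rfl
@[simp] lemma safe_load : (load a).Safe V s ↔ a.Safe V s := Iff.rfl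

end

/-- The number of elementary operations of the compiled expression. -/
def time : Expr ι → ℕ
  | const _ => 1
  | var _ => 2
  | add a b => a.time + b.time + 1
  | sub a b => a.time + b.time + 1
  | mul a b => a.time + b.time + 1
  | load a => a.time + 1

/-- A program that leaves the value of the expression in the register `d` and does not change
any register below `d`, where `idx` assigns registers below `d` to the variables. -/
def compile (idx : ι → ℕ) : ℕ → Expr ι → Prog
  | d, const c => .const d c
  -- The machine has no copy instruction, so the variable is added to zero.
  | d, var x => .seq (.const d 0) (.add d d (idx x))
  | d, add a b => .seq (a.compile idx d) (.seq (b.compile idx (d + 1)) (.add d d (d + 1)))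
  | d, sub a b => .seq (a.compile idx d) (.seq (b.compile idx (d + 1)) (.sub d d (d + 1)))
  | d, mul a b => .seq (a.compile idx d) (.seq (b.compile idx (d + 1)) (.mul d d (d + 1)))
  | d, load a => .seq (a.compile idx d) (.load d d)

end Expr

/-- Statements: assignments, writing to the memory, sequences, one-armed conditionals, and loops
in which a variable runs through the numbers below the value of another variable. -/
inductive Stm (ι : Type) where
  | assign (x : ι) (e : Expr ι)
  | store (a e : Expr ι)
  | seq (p q : Stm ι)
  | onlyIf (e : Expr ι) (p : Stm ι)
  | forTo (x y : ι) (p : Stm ι)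

/-- The machine runs from `s` to `s'` at cost at most `k * K`. -/
def Run (K : ℕ) (p : Prog) (s s' : State) (k : ℕ) : Prop :=
  ∃ c, Exec p s s' c ∧ c ≤ k * K

lemma Run.seq {K : ℕ} {p q : Prog} {s s₁ s₂ : State} {k₁ k₂ : ℕ} (h₁ : Run K p s s₁ k₁)
    (h₂ : Run K q s₁ s₂ k₂) : Run K (.seq p q) s s₂ (k₁ + k₂) := by
  obtain ⟨c₁, e₁, l₁⟩ := h₁
  obtain ⟨c₂, e₂, l₂⟩ := h₂
  exact ⟨_, .seq e₁ e₂, by rw [add_mul]; omega⟩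

lemma Run.mono {K : ℕ} {p : Prog} {s s' : State} {k k' : ℕ} (h : Run K p s s' k) (hk : k ≤ k') :
    Run K p s s' k' := by
  obtain ⟨c, e, l⟩ := h
  exact ⟨c, e, l.trans (Nat.mul_le_mul_right _ hk)⟩

/-- All numbers in the registers and in the memory are less than `2 ^ B`. -/
structure State.Within (B : ℕ) (s : State) : Prop where
  reg : ∀ r, s.reg r < 2 ^ B
  mem : ∀ x, s.mem x < 2 ^ B

lemma State.Within.setReg {B : ℕ} {s : State} (h : s.Within B) (d : ℕ) {v : ℕ} (hv : v < 2 ^ B) :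
    (s.setReg d v).Within B := by
  refine ⟨fun r => ?_, h.mem⟩
  by_cases hr : r = d
  · subst hr; simpa [State.setReg] using hv
  · simpa [State.setReg, hr] using h.reg r

lemma State.Within.setMem {B : ℕ} {s : State} (h : s.Within B) (d : ℕ) {v : ℕ} (hv : v < 2 ^ B) :
    (s.setMem d v).Within B := by
  refine ⟨h.reg, fun r => ?_⟩
  by_cases hr : r = d
  · subst hr; simpa [State.setMem] using hv
  · simpa [State.setMem, hr] using h.mem r

lemma State.Within.size_reg {B : ℕ} {s : State} (h : s.Within B) (r : ℕ) :
    (s.reg r).size ≤ B := Nat.size_le.2 (h.reg r)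

lemma State.Within.size_mem {B : ℕ} {s : State} (h : s.Within B) (x : ℕ) :
    (s.mem x).size ≤ B := Nat.size_le.2 (h.mem x)

section atomic

variable {B : ℕ} {s : State}

lemma Run.const (s : State) (d : ℕ) {c : ℕ} (hc : c < 2 ^ B) :
    Run (1 + 2 * B) (.const d c) s (s.setReg d c) 1 :=
  ⟨_, .const s d c, by have := Nat.size_le.2 hc; omega⟩

lemma Run.add (h : s.Within B) (d a b : ℕ) :
    Run (1 + 2 * B) (.add d a b) s (s.setReg d (s.reg a + s.reg b)) 1 :=
  ⟨_, .add s d a b, by have := h.size_reg a; have := h.size_reg b; omega⟩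

lemma Run.sub (h : s.Within B) (d a b : ℕ) :
    Run (1 + 2 * B) (.sub d a b) s (s.setReg d (s.reg a - s.reg b)) 1 :=
  ⟨_, .sub s d a b, by have := h.size_reg a; have := h.size_reg b; omega⟩

lemma Run.mul (h : s.Within B) (d a b : ℕ) :
    Run (1 + 2 * B) (.mul d a b) s (s.setReg d (s.reg a * s.reg b)) 1 :=
  ⟨_, .mul s d a b, by have := h.size_reg a; have := h.size_reg b; omega⟩

lemma Run.load (h : s.Within B) (d a : ℕ) :
    Run (1 + 2 * B) (.load d a) s (s.setReg d (s.mem (s.reg a))) 1 :=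
  ⟨_, .load s d a, by have := h.size_reg a; have := h.size_mem (s.reg a); omega⟩

lemma Run.store (h : s.Within B) (a b : ℕ) :
    Run (1 + 2 * B) (.store a b) s (s.setMem (s.reg a) (s.reg b)) 1 :=
  ⟨_, .store s a b, by have := h.size_reg a; have := h.size_reg b; omega⟩

end atomic

/-- The machine state `s` represents the store `t`. -/
structure Represents {ι : Type} (idx : ι → ℕ) (s : State) (t : Store ι) : Prop where
  reg : ∀ x, s.reg (idx x) = t.var x
  mem : s.mem = t.mem

namespace Expr

variable {ι : Type} {idx : ι → ℕ} {B : ℕ}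

/-- The effect of a program that computes `v` in register `d` with scratch registers above `d`. -/
def Computes (B d : ℕ) (p : Prog) (s : State) (v k : ℕ) : Prop :=
  ∃ s', Run (1 + 2 * B) p s s' k ∧ s'.Within B ∧ s'.mem = s.mem ∧
    (∀ r < d, s'.reg r = s.reg r) ∧ s'.reg d = v

/-- The second operand is evaluated with scratch registers from `d + 1` on, so the first operand
survives in `d`. -/
lemma Computes.binary {d v w k l : ℕ} {p q : Prog} {s : State} {op : ℕ → ℕ → ℕ}
    {instr : ℕ → ℕ → ℕ → Prog} (hp : Computes B d p s v k)
    (hq : ∀ s' : State, s'.Within B → s'.mem = s.mem → (∀ r < d, s'.reg r = s.reg r) →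
      Computes B (d + 1) q s' w l)
    (hop : op v w < 2 ^ B)
    (hi : ∀ s' : State, s'.Within B →
      Run (1 + 2 * B) (instr d d (d + 1)) s' (s'.setReg d (op (s'.reg d) (s'.reg (d + 1)))) 1) :
    Computes B d (.seq p (.seq q (instr d d (d + 1)))) s (op v w) (k + l + 1) := by
  obtain ⟨s₁, r₁, b₁, m₁, f₁, v₁⟩ := hp
  obtain ⟨s₂, r₂, b₂, m₂, f₂, v₂⟩ := hq s₁ b₁ m₁ f₁
  have e : s₂.reg d = v := (f₂ d (by omega)).trans v₁
  refine ⟨_, (r₁.seq (r₂.seq (hi s₂ b₂))).mono (by omega), ?_, m₂.trans m₁, fun r hr => ?_, ?_⟩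
  · rw [e, v₂]; exact b₂.setReg d hop
  · simp only [State.setReg]
    rw [Function.update_of_ne (by omega), f₂ r (by omega), f₁ r hr]
  · simp [State.setReg, e, v₂]

lemma computes_compile (e : Expr ι) {d : ℕ} {s : State} {t : Store ι} (hd : ∀ x, idx x < d)
    (hs : s.Within B) (hr : Represents idx s t) (he : e.Safe (2 ^ B) t) :
    Computes B d (e.compile idx d) s (e.eval t) e.time := by
  -- All variables live below `d`, so code that changes only registers from `d` on preserves the
  -- represented store.
  have transfer : ∀ {d : ℕ}, (∀ x, idx x < d) → ∀ {s s' : State}, Represents idx s t →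
      s'.mem = s.mem → (∀ r < d, s'.reg r = s.reg r) → Represents idx s' t :=
    fun hd _ _ hr hm hf => ⟨fun x => (hf _ (hd x)).trans (hr.reg x), hm.trans hr.mem⟩
  have hd' : ∀ x, idx x < d + 1 := fun x => (hd x).trans (Nat.lt_succ_self d)
  induction e generalizing d s with
  | const c =>
    refine ⟨_, Run.const s d he, hs.setReg d he, rfl, fun r h => ?_, ?_⟩
    · simp [State.setReg, h.ne]
    · simp [State.setReg, eval]
  | var x =>
    have h1 := hs.setReg d (v := 0) (by positivity)
    refine ⟨_, (Run.const s d (by positivity)).seq (Run.add h1 d d (idx x)), h1.setReg d ?_, rfl,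
      fun r h => ?_, ?_⟩
    · simpa [State.setReg, (hd x).ne] using hs.reg (idx x)
    · simp [State.setReg, h.ne]
    · simp [State.setReg, (hd x).ne, eval, hr.reg]
  | add a b iha ihb =>
    exact (iha hd hs hr he.1 hd').binary (op := (· + ·)) (fun s' b' m' f' => ihb hd' b'
      (transfer hd hr m' f') he.2.1 fun x => (hd' x).trans (Nat.lt_succ_self _)) he.2.2
      fun s' hs' => Run.add hs' _ _ _
  | sub a b iha ihb =>
    refine (iha hd hs hr he.1 hd').binary (op := (· - ·)) (fun s' b' m' f' => ihb hd' b'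
      (transfer hd hr m' f') he.2 fun x => (hd' x).trans (Nat.lt_succ_self _)) ?_
      fun s' hs' => Run.sub hs' _ _ _
    -- A difference is at most its first operand, which already fits into a register; this is why
    -- `Safe` puts no bound on differences.
    obtain ⟨s', -, b', -, -, v'⟩ := iha hd hs hr he.1 hd'
    exact (Nat.sub_le _ _).trans_lt (v' ▸ b'.reg d)
  | mul a b iha ihb =>
    exact (iha hd hs hr he.1 hd').binary (op := (· * ·)) (fun s' b' m' f' => ihb hd' b'
      (transfer hd hr m' f') he.2.1 fun x => (hd' x).trans (Nat.lt_succ_self _)) he.2.2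
      fun s' hs' => Run.mul hs' _ _ _
  | load a iha =>
    obtain ⟨s', r', b', m', f', v'⟩ := iha hd hs hr he hd'
    refine ⟨_, r'.seq (Run.load b' d d), b'.setReg d (b'.mem _), m', fun r h => ?_, ?_⟩
    · simp [State.setReg, h.ne, f' r h]
    · simp [State.setReg, v', m', hr.mem, eval]

end Expr

namespace Stm

variable {ι : Type} [DecidableEq ι]

/-- The state of a loop with body `f` after `i` rounds. -/
def iter (f : Store ι → Store ι) (x : ι) (s : Store ι) : ℕ → Store ι
  | 0 => s.setVar x 0
  | i + 1 => (f (iter f x s i)).setVar x (i + 1)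

/-- The effect of a statement. -/
def exec : Stm ι → Store ι → Store ι
  | assign x e, s => s.setVar x (e.eval s)
  | store a e, s => s.setMem (a.eval s) (e.eval s)
  | seq p q, s => q.exec (p.exec s)
  | onlyIf e p, s => if e.eval s = 0 then s else p.exec s
  | forTo x y p, s => iter p.exec x s (s.var y)

/-- All numbers that are formed are less than `V`, and all loops have at most `N` rounds. -/
def Safe (V N : ℕ) : Stm ι → Store ι → Prop
  | assign _ e, s => e.Safe V s
  | store a e, s => a.Safe V s ∧ e.Safe V s
  | seq p q, s => p.Safe V N s ∧ q.Safe V N (p.exec s)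
  | onlyIf e p, s => e.Safe V s ∧ (e.eval s ≠ 0 → p.Safe V N s)
  | forTo x y p, s => 1 < V ∧ s.var y ≤ N ∧ ∀ i < s.var y, p.Safe V N (iter p.exec x s i)

omit [DecidableEq ι] in
/-- The statement contains no assignment to the variable `x`. -/
def Keeps (x : ι) : Stm ι → Prop
  | assign y _ => x ≠ y
  | store _ _ => True
  | seq p q => p.Keeps x ∧ q.Keeps x
  | onlyIf _ p => p.Keeps x
  | forTo y _ p => x ≠ y ∧ p.Keeps x

/-- The statement does not write to the memory. -/
def KeepsMem : Stm ι → Prop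
  | assign _ _ => True
  | store _ _ => False
  | seq p q => p.KeepsMem ∧ q.KeepsMem
  | onlyIf _ p => p.KeepsMem
  | forTo _ _ p => p.KeepsMem

/-- No loop assigns to its counter or to its bound. -/
def WellFormed : Stm ι → Prop
  | assign _ _ => True
  | store _ _ => True
  | seq p q => p.WellFormed ∧ q.WellFormed
  | onlyIf _ p => p.WellFormed
  | forTo x y p => x ≠ y ∧ p.Keeps x ∧ p.Keeps y ∧ p.WellFormed

lemma exec_seq (p q : Stm ι) (s : Store ι) : (seq p q).exec s = q.exec (p.exec s) := rfl

lemma iter_var {f : Store ι → Store ι} {x z : ι} (hz : z ≠ x)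
    (hf : ∀ s, (f s).var z = s.var z) (s : Store ι) (i : ℕ) : (iter f x s i).var z = s.var z := by
  induction i with
  | zero => exact s.setVar_var_of_ne hz 0
  | succ i ih => rw [iter, Store.setVar_var_of_ne _ hz, hf, ih]

lemma iter_var_self (f : Store ι → Store ι) (x : ι) (s : Store ι) (i : ℕ) :
    (iter f x s i).var x = i := by
  cases i <;> simp [iter]

lemma iter_mem {f : Store ι → Store ι} (hf : ∀ s, (f s).mem = s.mem) (x : ι) (s : Store ι)
    (i : ℕ) : (iter f x s i).mem = s.mem := by
  induction i with
  | zero => rfl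
  | succ i ih => rw [iter, Store.setVar_mem, hf, ih]

lemma exec_var {x : ι} (p : Stm ι) (h : p.Keeps x) (s : Store ι) :
    (p.exec s).var x = s.var x := by
  induction p generalizing s with
  | assign y e => exact s.setVar_var_of_ne h _
  | store a e => rfl
  | seq p q ihp ihq => rw [exec, ihq h.2, ihp h.1]
  | onlyIf e p ih =>
    rw [exec]
    split
    · rfl
    · exact ih h s
  | forTo y z p ih => exact iter_var h.1 (ih h.2) s _

lemma exec_mem (p : Stm ι) (h : p.KeepsMem) (s : Store ι) : (p.exec s).mem = s.mem := by
  induction p generalizing s with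
  | assign y e => rfl
  | store a e => exact h.elim
  | seq p q ihp ihq => rw [exec, ihq h.2, ihp h.1]
  | onlyIf e p ih =>
    rw [exec]
    split
    · rfl
    · exact ih h s
  | forTo y z p ih => exact iter_mem (ih h) y s _

omit [DecidableEq ι] in
/-- The machine program of a statement, where `idx` assigns registers below `d` to the
variables. -/
def compile (idx : ι → ℕ) (d : ℕ) : Stm ι → Prog
  | assign x e => .seq (e.compile idx d) (.seq (.const (d + 1) 0) (.add (idx x) d (d + 1)))
  | store a e => .seq (a.compile idx d) (.seq (e.compile idx (d + 1)) (.store d (d + 1)))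
  | seq p q => .seq (p.compile idx d) (q.compile idx d)
  -- The else branch only overwrites the scratch register `d`, so it acts as a no-op.
  | onlyIf e p => .seq (e.compile idx d) (.cond d (p.compile idx d) (.const d 0))
  | forTo x y p =>
    -- The loop tests `y - x` in register `d`; it is recomputed at the end of each round because the
    -- body may overwrite `d`.
    .seq (.const (idx x) 0) (.seq ((Expr.var y - Expr.var x).compile idx d)
      (.loop d (.seq (p.compile idx d)
        (.seq (.seq ((Expr.var x + 1).compile idx d)
          (.seq (.const (d + 1) 0) (.add (idx x) d (d + 1))))
          ((Expr.var y - Expr.var x).compile idx d)))))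

open Polynomial in
omit [DecidableEq ι] in
/-- The number of elementary operations, as a polynomial in the bound for the number of rounds
of all loops. -/
noncomputable def time : Stm ι → Polynomial ℕ
  | assign _ e => C (e.time + 2)
  | store a e => C (a.time + e.time + 1)
  | seq p q => p.time + q.time
  | onlyIf e p => C (e.time + 2) + p.time
  -- 7 = 1 (reset of the counter) + 5 (computing `y - x`) + 1 (final test); 12 = 1 (test) + 6
  -- (increment) + 5 (recomputing `y - x`).
  | forTo _ _ p => C 7 + X * (C 12 + p.time)

/-! ### Correctness and cost of compiled statements -/

section correctness

variable {idx : ι → ℕ} {d B : ℕ}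

/-- The program `p` takes each representation of `t` to a representation of `t'` in `k` steps. -/
def Simulates (idx : ι → ℕ) (B : ℕ) (p : Prog) (t t' : Store ι) (k : ℕ) : Prop :=
  ∀ s : State, s.Within B → Represents idx s t →
    ∃ s', Run (1 + 2 * B) p s s' k ∧ s'.Within B ∧ Represents idx s' t'

omit [DecidableEq ι] in
lemma Simulates.seq {p q : Prog} {t t₁ t₂ : Store ι} {k l : ℕ} (hp : Simulates idx B p t t₁ k)
    (hq : Simulates idx B q t₁ t₂ l) : Simulates idx B (.seq p q) t t₂ (k + l) := by
  intro s hs hr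
  obtain ⟨s₁, r₁, b₁, h₁⟩ := hp s hs hr
  obtain ⟨s₂, r₂, b₂, h₂⟩ := hq s₁ b₁ h₁
  exact ⟨s₂, r₁.seq r₂, b₂, h₂⟩

lemma simulates_assign (hi : idx.Injective) (hd : ∀ x, idx x < d) (x : ι) (e : Expr ι)
    {t : Store ι} (he : e.Safe (2 ^ B) t) :
    Simulates idx B ((assign x e).compile idx d) t (t.setVar x (e.eval t)) (e.time + 2) := by
  intro s hs hr
  obtain ⟨s₁, r₁, b₁, m₁, f₁, v₁⟩ := e.computes_compile hd hs hr he
  have b₂ := b₁.setReg (d + 1) (v := 0) (by positivity)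
  refine ⟨_, r₁.seq ((Run.const _ _ (by positivity)).seq (Run.add b₂ _ _ _)), b₂.setReg _ ?_,
    fun y => ?_, m₁.trans hr.mem⟩
  · simpa [State.setReg] using b₁.reg d
  · by_cases hxy : y = x
    · subst hxy
      simp [State.setReg, v₁]
    · have := (hd y).trans (Nat.lt_succ_self d)
      simp [State.setReg, hi.ne hxy, this.ne, f₁ _ (hd y), hr.reg, Store.setVar_var_of_ne _ hxy]

lemma simulates_compile (hi : idx.Injective) (hd : ∀ x, idx x < d) {N : ℕ} (p : Stm ι)
    (hw : p.WellFormed) {t : Store ι} (hp : p.Safe (2 ^ B) N t) :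
    Simulates idx B (p.compile idx d) t (p.exec t) (p.time.eval N) := by
  induction p generalizing t with
  | assign x e => simpa [time, exec] using simulates_assign hi hd x e hp
  | store a e =>
    intro s hs hr
    have hd' : ∀ x, idx x < d + 1 := fun x => (hd x).trans (Nat.lt_succ_self d)
    obtain ⟨s₁, r₁, b₁, m₁, f₁, v₁⟩ := a.computes_compile hd hs hr hp.1
    have h₁ : Represents idx s₁ t :=
      ⟨fun x => (f₁ _ (hd x)).trans (hr.reg x), m₁.trans hr.mem⟩
    obtain ⟨s₂, r₂, b₂, m₂, f₂, v₂⟩ := e.computes_compile hd' b₁ h₁ hp.2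
    refine ⟨_, (r₁.seq (r₂.seq (Run.store b₂ _ _))).mono ?_, b₂.setMem _ (b₂.reg _), fun x => ?_,
      ?_⟩
    · simp [time, add_assoc]
    · simp [State.setMem, exec, f₂ _ (hd' x), h₁.reg]
    · simp [State.setMem, exec, f₂ d (Nat.lt_succ_self d), v₁, v₂, m₂, h₁.mem]
  | seq p q ihp ihq =>
    simpa [time, compile, exec] using (ihp hw.1 hp.1).seq (ihq hw.2 hp.2)
  | onlyIf e p ih =>
    intro s hs hr
    obtain ⟨s₁, r₁, b₁, m₁, f₁, v₁⟩ := e.computes_compile hd hs hr hp.1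
    have h₁ : Represents idx s₁ t :=
      ⟨fun x => (f₁ _ (hd x)).trans (hr.reg x), m₁.trans hr.mem⟩
    by_cases h0 : e.eval t = 0
    · have hx : Run (1 + 2 * B) (.cond d (p.compile idx d) (.const d 0)) s₁ (s₁.setReg d 0) 2 :=
        ⟨_, .cond_false (v₁.trans h0) (.const _ _ _), by simp⟩
      refine ⟨_, (r₁.seq hx).mono ?_, b₁.setReg d (by positivity), fun x => ?_, ?_⟩
      · simp [time]
      · simp [State.setReg, (hd x).ne, exec, h0, h₁.reg]
      · simpa [State.setReg, exec, h0] using h₁.mem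
    · obtain ⟨s₂, ⟨c, e₂, l₂⟩, b₂, h₂⟩ := ih hw (hp.2 h0) s₁ b₁ h₁
      have hx : Run (1 + 2 * B) (.cond d (p.compile idx d) (.const d 0)) s₁ s₂
          (1 + p.time.eval N) := by
        refine ⟨_, .cond_true (by rw [v₁]; exact h0) e₂, ?_⟩
        have := b₁.size_reg d
        rw [add_mul]
        omega
      refine ⟨_, (r₁.seq hx).mono ?_, b₂, ?_⟩
      · simp [time]; omega
      · simpa [exec, h0] using h₂
  | forTo x y p ih =>
    obtain ⟨hxy, hkx, hky, hwp⟩ := hw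
    obtain ⟨hV, hN, hsafe⟩ := hp
    have hvy : ∀ i, (iter p.exec x t i).var y = t.var y := fun i =>
      iter_var hxy.symm (p.exec_var hky) t i
    have hvx := iter_var_self p.exec x t
    have test : ∀ i, ∀ s : State, s.Within B → Represents idx s (iter p.exec x t i) →
        ∃ s', Run (1 + 2 * B) ((Expr.var y - Expr.var x).compile idx d) s s' 5 ∧ s'.Within B ∧
          Represents idx s' (iter p.exec x t i) ∧ s'.reg d = t.var y - i := by
      intro i s hs hr
      obtain ⟨s₁, r₁, b₁, m₁, f₁, v₁⟩ :=
        (Expr.var y - Expr.var x).computes_compile hd hs hr (by simp)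
      exact ⟨s₁, r₁, b₁, ⟨fun z => (f₁ _ (hd z)).trans (hr.reg z), m₁.trans hr.mem⟩,
        by simpa [hvx, hvy] using v₁⟩
    -- Induction on the number `m` of remaining rounds, with `i` rounds done.
    have loop : ∀ m i, i + m = t.var y → ∀ s : State, s.Within B →
        Represents idx s (iter p.exec x t i) → s.reg d = t.var y - i →
        ∃ s', Run (1 + 2 * B) (.loop d (.seq (p.compile idx d)
          (.seq ((assign x (Expr.var x + 1)).compile idx d)
            ((Expr.var y - Expr.var x).compile idx d)))) s s' (1 + m * (12 + p.time.eval N)) ∧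
          s'.Within B ∧ Represents idx s' (iter p.exec x t (t.var y)) := by
      intro m
      induction m with
      | zero =>
        intro i hi' s hs hr h0
        obtain rfl : i = t.var y := by omega
        exact ⟨s, ⟨1, .loop_done (by omega), by omega⟩, hs, hr⟩
      | succ m ihm =>
        intro i hi' s hs hr h0
        obtain ⟨s₁, r₁, b₁, h₁⟩ := ih hwp (hsafe i (by omega)) s hs hr
        have hx1 : (p.exec (iter p.exec x t i)).var x = i := by rw [p.exec_var hkx, hvx]
        -- The counter never exceeds the loop bound, whose value sits in a register.
        have hlt : i + 1 < 2 ^ B := by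
          have h2 := hs.reg (idx y)
          rw [hr.reg, hvy] at h2
          omega
        obtain ⟨s₂, r₂, b₂, h₂⟩ := simulates_assign hi hd x (Expr.var x + 1)
          (t := p.exec (iter p.exec x t i)) ⟨trivial, hV, by simpa [hx1] using hlt⟩ s₁ b₁ h₁
        -- The machine increments `x`, while `iter` sets it to `i + 1`; these agree because the body
        -- keeps `x`.
        have h₂' : Represents idx s₂ (iter p.exec x t (i + 1)) := by
          simpa [hx1, iter] using h₂
        obtain ⟨s₃, r₃, b₃, h₃, v₃⟩ := test (i + 1) s₂ b₂ h₂'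
        obtain ⟨c', e', l'⟩ := r₁.seq (r₂.seq r₃)
        obtain ⟨s₄, ⟨c, e₄, l₄⟩, b₄, h₄⟩ := ihm (i + 1) (by omega) s₃ b₃ h₃ v₃
        refine ⟨s₄, ⟨_, .loop_step (by omega) e' e₄, ?_⟩, b₄, h₄⟩
        have h6 : (Expr.var x + 1).time = 4 := rfl
        rw [h6] at l'
        have := hs.size_reg d
        have e5 : (1 + (m + 1) * (12 + p.time.eval N)) * (1 + 2 * B) =
            (1 + 2 * B) + (p.time.eval N + (4 + 2 + 5)) * (1 + 2 * B) +
              (1 + m * (12 + p.time.eval N)) * (1 + 2 * B) := by ring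
        omega
    intro s hs hr
    have b₁ := hs.setReg (idx x) (v := 0) (by positivity)
    have h₁ : Represents idx (s.setReg (idx x) 0) (iter p.exec x t 0) := by
      refine ⟨fun z => ?_, hr.mem⟩
      by_cases hz : z = x
      · subst hz; simp [State.setReg, iter]
      · simp [State.setReg, iter, hi.ne hz, hr.reg, Store.setVar_var_of_ne _ hz]
    obtain ⟨s₂, r₂, b₂, h₂, v₂⟩ := test 0 _ b₁ h₁
    obtain ⟨s₃, r₃, b₃, h₃⟩ := loop (t.var y) 0 (by omega) s₂ b₂ h₂ v₂
    refine ⟨s₃, ((Run.const s (idx x) (by positivity)).seq (r₂.seq r₃)).mono ?_, b₃, h₃⟩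
    simp only [time, Polynomial.eval_add, Polynomial.eval_mul, Polynomial.eval_C,
      Polynomial.eval_X]
    have := Nat.mul_le_mul_right (12 + p.time.eval N) hN
    omega

end correctness

/-- Each well-formed statement has a machine program with the same effect on the memory. -/
theorem exists_prog [Finite ι] (p : Stm ι) (hw : p.WellFormed) :
    ∃ P : Prog, ∀ (B N : ℕ) (input : List ℕ), (∀ v ∈ input, v < 2 ^ B) →
      p.Safe (2 ^ B) N (Store.init input) →
      ∃ s c, Exec P (State.init input) s c ∧ c ≤ p.time.eval N * (1 + 2 * B) ∧
        s.mem = (p.exec (Store.init input)).mem := by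
  -- The `d` variables occupy the first `d` registers; all registers from `d` on are scratch.
  obtain ⟨d, ⟨f⟩⟩ := Finite.exists_equiv_fin ι
  refine ⟨p.compile (fun x => (f x : ℕ)) d, fun B N input hB hs => ?_⟩
  have hb : (State.init input).Within B := by
    refine ⟨fun _ => by simp [State.init], fun a => ?_⟩
    by_cases ha : a < input.length
    · simpa [State.init, ha] using hB _ (List.getElem_mem ha)
    · simp [State.init, ha]
  obtain ⟨s, ⟨c, h, l⟩, -, hr⟩ := p.simulates_compile (d := d) (B := B)
    (Fin.val_injective.comp f.injective) (fun x => (f x).isLt) hw hs (State.init input)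
    hb ⟨fun _ => rfl, rfl⟩
  exact ⟨s, c, h, l, hr.mem⟩

end Stm

end Ram

/-! ## Rounding monotone sequences to breakpoints -/

section rounding

lemma exists_neighbours {C : Finset ℕ} {a b v : ℕ} (ha : a ∈ C) (hb : b ∈ C) (hav : a ≤ v)
    (hvb : v ≤ b) : ∃ c ∈ C, ∃ c' ∈ C, c ≤ v ∧ v ≤ c' ∧ (∀ e ∈ C, e ≤ v → e ≤ c) ∧
      ∀ e ∈ C, v ≤ e → c' ≤ e := by
  have h1 : (C.filter (· ≤ v)).Nonempty := ⟨a, by simp [ha, hav]⟩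
  have h2 : (C.filter (v ≤ ·)).Nonempty := ⟨b, by simp [hb, hvb]⟩
  have m1 := Finset.mem_filter.1 ((C.filter (· ≤ v)).max'_mem h1)
  have m2 := Finset.mem_filter.1 ((C.filter (v ≤ ·)).min'_mem h2)
  refine ⟨_, m1.1, _, m2.1, m1.2, m2.2, fun e he hev => ?_, fun e he hev => ?_⟩
  · exact Finset.le_max' _ _ (by simp [he, hev])
  · exact Finset.min'_le _ _ (by simp [he, hev])

lemma sum_threshold {D A : ℕ} (hA : A ≤ D) (u v : ℕ) :
    ∑ θ ∈ Finset.range D, (if θ < A then u else v) = A * u + (D - A) * v := by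
  obtain ⟨m, rfl⟩ := Nat.exists_eq_add_of_le hA
  rw [Finset.sum_range_add, Nat.add_sub_cancel_left]
  congr 1
  · rw [Finset.sum_congr rfl fun x hx => if_pos (Finset.mem_range.1 hx)]
    simp
  · simp

/-- If the functions `g k` are affine between consecutive points of `C`, then a monotone sequence
`x` can be rounded to a monotone sequence in `C` without increasing `∑ k, g k (x k)`. -/
theorem exists_rounding {n a b : ℕ} {C : Finset ℕ} (ha : a ∈ C) (hb : b ∈ C)
    (g : Fin n → ℕ → ℕ)
    (hg : ∀ k, ∀ c ∈ C, ∀ c' ∈ C, ∀ v, a ≤ c → c ≤ v → v ≤ c' →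
      (∀ e ∈ C, e ≤ c ∨ c' ≤ e) → (c' - c) * g k v = (v - c) * g k c' + (c' - v) * g k c)
    (x : Fin n → ℕ) (hx : Monotone x) (hax : ∀ k, a ≤ x k) (hxb : ∀ k, x k ≤ b) :
    ∃ y : Fin n → ℕ, Monotone y ∧ (∀ k, y k ∈ C ∧ a ≤ y k ∧ y k ≤ b) ∧
      ∑ k, g k (y k) ≤ ∑ k, g k (x k) := by
  choose lo hlo hi hhi hlv hvh hl hh using fun k => exists_neighbours ha hb (hax k) (hxb k)
  -- The threshold is uniform on `D` values. Every gap between neighbours is at most `b`, hence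
  -- divides `D`, so all rounding probabilities are exact multiples of 1 / D.
  set D := b.factorial with hD
  have hD0 : 0 < D := b.factorial_pos
  -- `A k / D` is the relative position of `x k` in its gap, the probability of rounding up. For an
  -- empty gap it is 0 and both choices coincide.
  set A : Fin n → ℕ := fun k => (x k - lo k) * (D / (hi k - lo k)) with hAdef
  have hdvd : ∀ k, lo k < hi k → (hi k - lo k) * (D / (hi k - lo k)) = D := fun k h =>
    Nat.mul_div_cancel' (Nat.dvd_factorial (by omega) (by have := hh k b hb (hxb k); omega))
  have hA : ∀ k, A k ≤ D := fun k =>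
    (Nat.mul_le_mul_right _ (Nat.sub_le_sub_right (hvh k) _)).trans (Nat.mul_div_le _ _)
  have hsum : ∀ k, ∑ θ ∈ Finset.range D, g k (if θ < A k then hi k else lo k) = D * g k (x k) := by
    intro k
    have h1 : ∀ θ, g k (if θ < A k then hi k else lo k) =
        if θ < A k then g k (hi k) else g k (lo k) := fun θ => apply_ite _ _ _ _
    simp only [h1]
    rw [sum_threshold (hA k)]
    rcases (hlv k).trans (hvh k) |>.eq_or_lt with h | h
    · have h2 : x k = hi k := le_antisymm (hvh k) (h ▸ hlv k)
      simp [hAdef, h, h2]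
    · have h3 := hg k _ (hlo k) _ (hhi k) (x k) (hl k a ha (hax k)) (hlv k) (hvh k)
        fun e he => (le_total e (x k)).imp (hl k e he) (hh k e he)
      have h4 := hdvd k h
      have h5 : D - A k = (hi k - x k) * (D / (hi k - lo k)) := by
        have : D = (hi k - x k) * (D / (hi k - lo k)) + A k := by
          rw [hAdef, ← add_mul, Nat.sub_add_sub_cancel (hvh k) (hlv k), h4]
        omega
      rw [h5]
      calc _ = (D / (hi k - lo k)) *
            ((x k - lo k) * g k (hi k) + (hi k - x k) * g k (lo k)) := by
              simp only [hAdef]; ring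
        _ = ((hi k - lo k) * (D / (hi k - lo k))) * g k (x k) := by rw [← h3]; ring
        _ = D * g k (x k) := by rw [h4]
  -- Averaging: by `hsum` the total over all `θ` is `D` times the original value, so some `θ` does
  -- not exceed it.
  obtain ⟨θ, -, hθ⟩ := Finset.exists_le_of_sum_le (s := Finset.range D)
    (f := fun θ => ∑ k, g k (if θ < A k then hi k else lo k)) (g := fun _ => ∑ k, g k (x k))
    ⟨0, Finset.mem_range.2 hD0⟩ (by
      rw [Finset.sum_comm, Finset.sum_congr rfl fun k _ => hsum k]
      simp [Finset.mul_sum])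
  refine ⟨fun k => if θ < A k then hi k else lo k, fun k k' hk => ?_, fun k => ?_, hθ⟩
  · have hxx := hx hk
    have b1 := (hlv k).trans (hvh k)
    have b2 := (hlv k').trans (hvh k')
    -- Either the gap of `x k` lies entirely below that of `x k'`, or both points lie in the same
    -- gap and the common threshold preserves their order.
    by_cases hc : hi k ≤ lo k'
    · dsimp only
      split_ifs <;> omega
    · have e1 : lo k' < x k := lt_of_not_ge fun h => hc (hh k _ (hlo k') h)
      have e2 : x k' < hi k := lt_of_not_ge fun h => hc (hl k' _ (hhi k) h)
      have e3 : lo k = lo k' :=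
        le_antisymm (hl k' _ (hlo k) ((hlv k).trans hxx)) (hl k _ (hlo k') e1.le)
      have e4 : hi k = hi k' :=
        le_antisymm (hh k _ (hhi k') (hxx.trans (hvh k'))) (hh k' _ (hhi k) e2.le)
      have e5 : A k ≤ A k' := by
        simp only [hAdef, e3, e4]
        exact Nat.mul_le_mul_right _ (Nat.sub_le_sub_right hxx _)
      dsimp only
      split_ifs <;> omega
  · have h1 := hl k a ha (hax k)
    have h2 := hh k b hb (hxb k)
    have h3 := (hlv k).trans (hvh k)
    dsimp only
    split_ifs
    · exact ⟨hhi k, by omega, h2⟩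
    · exact ⟨hlo k, h1, by omega⟩

end rounding

/-! ## Monotone sequences of minimum total value by dynamic programming -/

namespace MonotoneDP

/-- An index `b` of minimum `f b` among `c` and the indices below `m` with `X b ≤ X c`. -/
def argmin (X f : ℕ → ℕ) (c : ℕ) : ℕ → ℕ
  | 0 => c
  | m + 1 => if X m ≤ X c ∧ f m < f (argmin X f c m) then m else argmin X f c m

section argmin

variable (X f : ℕ → ℕ) (c m : ℕ)

lemma argmin_lt {M : ℕ} (hc : c < M) (hm : m ≤ M) : argmin X f c m < M := by
  induction m with
  | zero => exact hc
  | succ m ih =>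
    rw [argmin]
    split_ifs
    · omega
    · exact ih (by omega)

lemma apply_argmin_le : X (argmin X f c m) ≤ X c := by
  induction m with
  | zero => exact le_rfl
  | succ m ih =>
    rw [argmin]
    split_ifs with h
    · exact h.1
    · exact ih

lemma argmin_min {b : ℕ} (hb : b < m) (hX : X b ≤ X c) : f (argmin X f c m) ≤ f b := by
  induction m with
  | zero => omega
  | succ m ih =>
    rw [argmin]
    rcases Nat.lt_succ_iff_lt_or_eq.1 hb with h | rfl
    · have := ih h
      split_ifs <;> omega
    · split_ifs with h2
      · exact le_rfl
      · exact not_lt.1 fun h3 => h2 ⟨hX, h3⟩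

end argmin

variable (X : ℕ → ℕ) (M : ℕ) (g : ℕ → ℕ → ℕ)

/-- `table X M g (k + 1) c` is the minimum of `∑ i ≤ k, g i (X (y i))` over all sequences of
indices `y i < M` with `X (y i)` monotone and `y k = c`. -/
def table : ℕ → ℕ → ℕ
  | 0, _ => 0
  | k + 1, c => g k (X c) + table k (argmin X (table k) c M)

/-- The predecessor `y k` is admissible in the minimum that defines the next entry at `y (k + 1)`,
so the bound propagates by induction. -/
lemma table_le (k : ℕ) (y : ℕ → ℕ) (hy : ∀ i ≤ k, y i < M)
    (hX : ∀ i < k, X (y i) ≤ X (y (i + 1))) :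
    table X M g (k + 1) (y k) ≤ ∑ i ∈ Finset.range (k + 1), g i (X (y i)) := by
  induction k with
  | zero => simp [table]
  | succ k ih =>
    rw [Finset.sum_range_succ, table, add_comm]
    have h1 := argmin_min X (table X M g (k + 1)) (y (k + 1)) M (hy k (by omega)) (hX k (by omega))
    have h2 := ih (fun i hi => hy i (by omega)) fun i hi => hX i (by omega)
    omega

/-- The indices of an optimal sequence of length `n`, from its end to its beginning, preceded by
the last index. -/
def path (n : ℕ) : ℕ → ℕ
  -- A sentinel: when `X (M - 1)` is at least every value used, the minimisation for the last
  -- position is unconstrained.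
  | 0 => M - 1
  | t + 1 => argmin X (table X M g (n - t)) (path n t) M

variable {M}

lemma path_lt (hM : 0 < M) (n t : ℕ) : path X M g n t < M := by
  induction t with
  | zero => exact Nat.sub_lt hM one_pos
  | succ t ih => exact argmin_lt _ _ _ _ ih le_rfl

variable (M)

lemma apply_path_le {n s t : ℕ} (h : s ≤ t) : X (path X M g n t) ≤ X (path X M g n s) :=
  antitone_nat_of_succ_le (f := fun t => X (path X M g n t)) (fun _ => apply_argmin_le _ _ _ _) h

/-- The path repeats the very choices made in the recursion of the table, so no predecessors need to
be stored. -/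
lemma table_path {n k : ℕ} (hk : k ≤ n) : table X M g k (path X M g n (n - k + 1)) =
    ∑ i ∈ Finset.range k, g i (X (path X M g n (n - i))) := by
  induction k with
  | zero => simp [table]
  | succ k ih =>
    rw [Finset.sum_range_succ, ← ih (by omega), table, show n - (k + 1) + 1 = n - k by omega, path,
      show n - (n - k) = k by omega, add_comm]

variable {M}

theorem sum_path_le (n : ℕ) (y : ℕ → ℕ) (hy : ∀ i < n, y i < M)
    (hX : ∀ i, i + 1 < n → X (y i) ≤ X (y (i + 1))) (hM : ∀ i < n, X (y i) ≤ X (M - 1)) :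
    ∑ i ∈ Finset.range n, g i (X (path X M g n (n - i))) ≤
      ∑ i ∈ Finset.range n, g i (X (y i)) := by
  rw [← table_path X M g le_rfl]
  rcases n with _ | n
  · simp [table]
  · refine le_trans ?_ (table_le X M g n y (fun i hi => hy i (by omega))
      fun i hi => hX i (by omega))
    rw [Nat.sub_self, path]
    exact argmin_min _ _ _ _ (hy n (by omega)) (hM n (by omega))

end MonotoneDP

/-! ## Optimal schedules -/

namespace CarbonInstance

variable (I : CarbonInstance)

/-- The running time of task `i`, and `0` if there is no such task. -/
def durAt (i : ℕ) : ℕ := if h : i < I.n then I.dur ⟨i, h⟩ else 0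

/-- The length of interval `j`, and `0` if there is no such interval. -/
def lenAt (j : ℕ) : ℕ := if h : j < I.J then I.len ⟨j, h⟩ else 0

/-- The green power budget of interval `j`, and `0` if there is no such interval. -/
def greenAt (j : ℕ) : ℕ := if h : j < I.J then I.green ⟨j, h⟩ else 0

/-- The beginning of interval `j`. -/
def boundary (j : ℕ) : ℕ := ∑ i ∈ Finset.range j, I.lenAt i

/-- The total running time of the first `i` tasks. -/
def before (i : ℕ) : ℕ := ∑ k ∈ Finset.range i, I.durAt k

/-- The total running time of the tasks from `i` on. -/
def rest (i : ℕ) : ℕ := I.before I.n - I.before i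

/-- The additional carbon cost of a time unit of work in interval `j`. -/
def weight (j : ℕ) : ℕ := (I.idle + I.work - I.greenAt j) - (I.idle - I.greenAt j)

/-- The additional carbon cost of work in the time units `lo ≤ t < hi`. -/
def excess (lo hi : ℕ) : ℕ := ∑ j ∈ Finset.range I.J,
  I.weight j * (min hi (I.boundary (j + 1)) - max lo (I.boundary j))

/-- The additional carbon cost of task `k` if it starts at `x - I.rest k`. -/
def taskCost (k x : ℕ) : ℕ := I.excess (x - I.rest k) (x - I.rest k + I.durAt k)

lemma durAt_val (i : Fin I.n) : I.durAt i = I.dur i := by simp [durAt]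
lemma lenAt_val (j : Fin I.J) : I.lenAt j = I.len j := by simp [lenAt]
lemma greenAt_val (j : Fin I.J) : I.greenAt j = I.green j := by simp [greenAt]

lemma boundary_succ (j : ℕ) : I.boundary (j + 1) = I.boundary j + I.lenAt j :=
  Finset.sum_range_succ _ _

lemma before_succ (i : ℕ) : I.before (i + 1) = I.before i + I.durAt i :=
  Finset.sum_range_succ _ _

lemma boundary_mono : Monotone I.boundary :=
  monotone_nat_of_le_succ fun j => by rw [boundary_succ]; omega

lemma before_mono : Monotone I.before :=
  monotone_nat_of_le_succ fun j => by rw [before_succ]; omega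

lemma T_eq : I.T = I.boundary I.J := by
  simp only [T, boundary, ← Fin.sum_univ_eq_sum_range, lenAt_val]

lemma b_eq (j : Fin I.J) : I.b j = I.boundary j := by
  rw [b, boundary]
  refine Finset.sum_bij (fun k _ => (k : ℕ)) ?_ ?_ ?_ ?_
  · intro k hk; simpa using hk
  · intro k _ l _ h; exact Fin.ext h
  · intro k hk
    have := Finset.mem_range.1 hk
    exact ⟨⟨k, by omega⟩, by simpa [Fin.lt_def] using this, rfl⟩
  · intro k _; exact (I.lenAt_val k).symm

lemma e_eq (j : Fin I.J) : I.e j = I.boundary (j + 1) := by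
  rw [e, b_eq, boundary_succ, lenAt_val]

lemma rest_eq {k : ℕ} (hk : k < I.n) : I.rest k = I.durAt k + I.rest (k + 1) := by
  have h1 := I.before_mono (show k + 1 ≤ I.n from hk)
  have h2 := I.before_succ k
  simp only [rest]
  omega

lemma rest_le (k : ℕ) : I.rest k ≤ I.before I.n := Nat.sub_le _ _

/-! ### The cost of a feasible schedule -/

/-- The carbon cost of an idle processor. -/
def baseCost : ℕ := ∑ j : Fin I.J, ∑ _t ∈ Finset.Ico (I.b j) (I.e j), (I.idle - I.green j)

-- Feasibility makes the execution intervals disjoint, so at most one summand is nonzero.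
open Classical in
lemma sum_active {σ : Fin I.n → ℕ} (hσ : I.Feasible σ) (t w : ℕ) :
    (if I.Active σ t then w else 0) =
      ∑ i, if σ i ≤ t ∧ t < σ i + I.dur i then w else 0 := by
  by_cases h : I.Active σ t
  · obtain ⟨i, hi⟩ := h
    rw [if_pos ⟨i, hi⟩, Finset.sum_eq_single i, if_pos hi]
    · intro k _ hk
      refine if_neg fun hk' => ?_
      rcases lt_or_gt_of_ne hk with h | h
      · have := hσ.1 _ _ h; omega
      · have := hσ.1 _ _ h; omega
    · simp
  · rw [if_neg h, Finset.sum_eq_zero]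
    exact fun i _ => if_neg fun hi => h ⟨i, hi⟩

/-- Separability: a time unit of work in interval `j` adds `weight j`, whichever task is executed,
and no time unit is counted for two tasks. -/
lemma cost_eq {σ : Fin I.n → ℕ} (hσ : I.Feasible σ) :
    I.cost σ = I.baseCost + ∑ i, I.excess (σ i) (σ i + I.dur i) := by
  classical
  have h1 : ∀ j : Fin I.J, ∀ t, I.power σ t - I.green j = (I.idle - I.green j) +
      ∑ i, if σ i ≤ t ∧ t < σ i + I.dur i then I.weight j else 0 := by
    intro j t
    rw [← I.sum_active hσ, power, weight, greenAt_val]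
    split_ifs <;> omega
  simp only [cost, h1, Finset.sum_add_distrib, baseCost]
  congr 1
  -- The sum counts the time units common to the task and the interval; truncated subtraction gives
  -- 0 when they are disjoint.
  have h2 : ∀ i j, ∑ t ∈ Finset.Ico (I.b j) (I.e j),
      (if σ i ≤ t ∧ t < σ i + I.dur i then I.weight j else 0) =
        I.weight j * (min (σ i + I.dur i) (I.boundary (j + 1)) -
          max (σ i) (I.boundary j)) := by
    intro i j
    rw [← Finset.sum_filter, Finset.sum_const, smul_eq_mul, mul_comm, ← Nat.card_Ico]
    congr 2
    ext t
    simp only [Finset.mem_filter, Finset.mem_Ico, b_eq, e_eq]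
    omega
  simp only [excess, ← Fin.sum_univ_eq_sum_range (fun j =>
    I.weight j * (min _ (I.boundary (j + 1)) - max _ (I.boundary j))), ← h2]
  rw [Finset.sum_congr rfl fun j _ => Finset.sum_comm, Finset.sum_comm]

/-! ### Breakpoints -/

/-- A function is affine on `[c, c']`. -/
def AffineOnIcc (c c' : ℕ) (f : ℕ → ℤ) : Prop :=
  ∀ v, c ≤ v → v ≤ c' → ((c' : ℤ) - c) * f v = (v - c) * f c' + (c' - v) * f c

variable {I} {c c' : ℕ}

lemma AffineOnIcc.sub {f g : ℕ → ℤ} (hf : AffineOnIcc c c' f) (hg : AffineOnIcc c c' g) :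
    AffineOnIcc c c' fun x => f x - g x := fun v h1 h2 => by
  linear_combination hf v h1 h2 - hg v h1 h2

lemma AffineOnIcc.const_mul {f : ℕ → ℤ} (hf : AffineOnIcc c c' f) (w : ℤ) :
    AffineOnIcc c c' fun x => w * f x := fun v h1 h2 => by
  linear_combination w * hf v h1 h2

lemma AffineOnIcc.sum {ι : Type} {s : Finset ι} {f : ι → ℕ → ℤ}
    (hf : ∀ i ∈ s, AffineOnIcc c c' (f i)) : AffineOnIcc c c' fun x => ∑ i ∈ s, f i x :=
  fun v h1 h2 => by
    rw [Finset.mul_sum, Finset.mul_sum, Finset.mul_sum, ← Finset.sum_add_distrib]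
    exact Finset.sum_congr rfl fun i hi => hf i hi v h1 h2

/-- The only kinks are at `q`, where the subtraction stops being truncated, and at `e + q`; the
hypotheses exclude both from the interior. -/
lemma AffineOnIcc.min_sub {q e : ℕ} (hq : q ≤ c) (h : e + q ≤ c ∨ c' ≤ e + q) :
    AffineOnIcc c c' fun x => (min (x - q) e : ℕ) := by
  intro v h1 h2
  dsimp only
  rcases h with h | h
  · rw [show min (v - q) e = e by omega, show min (c' - q) e = e by omega,
      show min (c - q) e = e by omega]
    ring
  · rw [show min (v - q) e = v - q by omega, show min (c' - q) e = c' - q by omega,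
      show min (c - q) e = c - q by omega]
    push_cast [show q ≤ v by omega, show q ≤ c' by omega, hq]
    ring

variable (I)

/-- The beginnings and ends of intervals, shifted by total running times of final sets of
tasks. -/
def breakpoints : Finset ℕ :=
  (Finset.range (I.J + 1) ×ˢ Finset.range (I.n + 1)).image fun p => I.boundary p.1 + I.rest p.2

lemma mem_breakpoints {j i : ℕ} (hj : j ≤ I.J) (hi : i ≤ I.n) :
    I.boundary j + I.rest i ∈ I.breakpoints :=
  Finset.mem_image.2 ⟨(j, i), by simp; omega, rfl⟩

lemma affineOnIcc_taskCost {k : ℕ} (hk : k < I.n) (hc : I.before I.n ≤ c)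
    (h : ∀ e ∈ I.breakpoints, e ≤ c ∨ c' ≤ e) :
    AffineOnIcc c c' fun x => (I.taskCost k x : ℤ) := by
  have hr := I.rest_eq hk
  have hle := I.rest_le k
  -- The overlap of [u, v) with [p, q) is (min v q - min v p) - (min u q - min u p). Here u = x -
  -- `rest k` is the start of the task and v = x - `rest (k + 1)` its end, so the kinks are
  -- breakpoints.
  have key : AffineOnIcc c c' fun x => ∑ j ∈ Finset.range I.J, (I.weight j : ℤ) *
      ((((min (x - I.rest (k + 1)) (I.boundary (j + 1)) : ℕ) : ℤ) -
        (min (x - I.rest (k + 1)) (I.boundary j) : ℕ)) -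
      (((min (x - I.rest k) (I.boundary (j + 1)) : ℕ) : ℤ) -
        (min (x - I.rest k) (I.boundary j) : ℕ))) := by
    refine .sum fun j hj => .const_mul (.sub (.sub (.min_sub (by omega) ?_) (.min_sub (by omega) ?_))
      (.sub (.min_sub (by omega) ?_) (.min_sub (by omega) ?_))) _
    all_goals
      have := Finset.mem_range.1 hj
      exact h _ (I.mem_breakpoints (by omega) (by omega))
  have e : ∀ x, I.before I.n ≤ x → (I.taskCost k x : ℤ) =
      ∑ j ∈ Finset.range I.J, (I.weight j : ℤ) *
      ((((min (x - I.rest (k + 1)) (I.boundary (j + 1)) : ℕ) : ℤ) -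
        (min (x - I.rest (k + 1)) (I.boundary j) : ℕ)) -
      (((min (x - I.rest k) (I.boundary (j + 1)) : ℕ) : ℤ) -
        (min (x - I.rest k) (I.boundary j) : ℕ))) := by
    intro x hx
    rw [taskCost, excess, Nat.cast_sum]
    refine Finset.sum_congr rfl fun j _ => ?_
    have := I.boundary_mono (Nat.le_add_right j 1)
    rw [Nat.cast_mul]
    congr 1
    omega
  intro v h1 h2
  have := key v h1 h2
  dsimp only at this ⊢
  rw [e v (by omega), e c' (by omega), e c hc, this]

/-! ### The optimal schedule -/

/-- The number of candidate points. -/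
def numCand : ℕ := (I.J + 1) * (I.n + 1)

/-- The candidate points: the breakpoints, confined to the feasible range. -/
def cand (c : ℕ) : ℕ := max (I.before I.n)
  (min (I.boundary I.J) (I.boundary (c / (I.n + 1)) + I.rest (c % (I.n + 1))))

lemma cand_eq (j : ℕ) {i : ℕ} (hi : i ≤ I.n) : I.cand (j * (I.n + 1) + i) =
    max (I.before I.n) (min (I.boundary I.J) (I.boundary j + I.rest i)) := by
  have h1 : (j * (I.n + 1) + i) / (I.n + 1) = j := by
    rw [mul_comm, Nat.mul_add_div (by omega), Nat.div_eq_of_lt (by omega), add_zero]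
  have h2 : (j * (I.n + 1) + i) % (I.n + 1) = i := by
    rw [mul_comm, Nat.mul_add_mod, Nat.mod_eq_of_lt (by omega)]
  rw [cand, h1, h2]

/-- The last index encodes the pair (J, n), and `rest n = 0`. This makes it the sentinel from which
`MonotoneDP.path` starts. -/
lemma cand_last (h : I.before I.n ≤ I.boundary I.J) :
    I.cand (I.numCand - 1) = I.boundary I.J := by
  rw [numCand, show (I.J + 1) * (I.n + 1) - 1 = I.J * (I.n + 1) + I.n by
    rw [add_mul]; omega, cand_eq _ _ le_rfl]
  omega

lemma numCand_pos : 0 < I.numCand := by unfold numCand; positivity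

lemma exists_cand {x : ℕ} (hx : x ∈ I.breakpoints) (h1 : I.before I.n ≤ x)
    (h2 : x ≤ I.boundary I.J) : ∃ c < I.numCand, I.cand c = x := by
  obtain ⟨⟨j, i⟩, hji, rfl⟩ := Finset.mem_image.1 hx
  simp only [Finset.mem_product, Finset.mem_range] at hji
  refine ⟨j * (I.n + 1) + i, ?_, ?_⟩
  · have := Nat.mul_le_mul_right (I.n + 1) (show j + 1 ≤ I.J + 1 by omega)
    rw [add_mul, one_mul] at this
    unfold numCand
    omega
  · dsimp only at h1 h2 ⊢
    rw [cand_eq _ _ (by omega)]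
    omega

/-- The minimum total costs of the first tasks. -/
def table : ℕ → ℕ → ℕ := MonotoneDP.table I.cand I.numCand I.taskCost

/-- The candidate points of an optimal schedule, from the last task to the first. -/
def path : ℕ → ℕ := MonotoneDP.path I.cand I.numCand I.taskCost I.n

/-- The start times of an optimal schedule. -/
def startTime (k : ℕ) : ℕ := I.cand (I.path (I.n - k)) - I.rest k

lemma before_le_T {σ : Fin I.n → ℕ} (hσ : I.Feasible σ) : I.before I.n ≤ I.boundary I.J := by
  have h : ∀ k, (hk : k < I.n) → I.before (k + 1) ≤ σ ⟨k, hk⟩ + I.dur ⟨k, hk⟩ := by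
    intro k
    induction k with
    | zero => intro hk; simp [before, durAt, hk]
    | succ k ih =>
      intro hk
      have h1 := ih (by omega)
      have h2 := hσ.1 ⟨k, by omega⟩ ⟨k + 1, hk⟩ (by simp)
      rw [before_succ, durAt, dif_pos hk]
      omega
  rcases hn : I.n with _ | m
  · simp [before]
  · rw [← T_eq]
    exact (h m (by omega)).trans (hσ.2 _)

section
variable {I}

lemma before_le_cand (c : ℕ) : I.before I.n ≤ I.cand c := le_max_left _ _

lemma cand_le (h : I.before I.n ≤ I.boundary I.J) (c : ℕ) : I.cand c ≤ I.boundary I.J := by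
  unfold cand; omega

/-- Task `i` ends at `x i - rest (i + 1)`, and `rest j ≤ rest (i + 1)` for `i < j`. The lower bound
on `x` prevents truncation. -/
lemma feasible_sub_rest {x : Fin I.n → ℕ} (hx : Monotone x) (h1 : ∀ k, I.before I.n ≤ x k)
    (h2 : ∀ k, x k ≤ I.boundary I.J) : I.Feasible fun k => x k - I.rest k := by
  have hr : ∀ k : Fin I.n, I.rest k = I.dur k + I.rest (k + 1) := fun k => by
    rw [I.rest_eq k.2, durAt_val]
  refine ⟨fun i j hij => ?_, fun i => ?_⟩
  · have := hx hij.le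
    have := hr i
    have := h1 i
    have := I.rest_le i
    have := I.before_mono (show (i : ℕ) + 1 ≤ j from hij)
    simp only [rest] at *
    omega
  · have := hr i
    have := h1 i
    have := h2 i
    have := I.rest_le i
    rw [T_eq]
    dsimp only
    omega

lemma cost_sub_rest {x : Fin I.n → ℕ} (hx : Monotone x) (h1 : ∀ k, I.before I.n ≤ x k)
    (h2 : ∀ k, x k ≤ I.boundary I.J) : I.cost (fun k => x k - I.rest k) =
      I.baseCost + ∑ k : Fin I.n, I.taskCost k (x k) := by
  rw [I.cost_eq (feasible_sub_rest hx h1 h2)]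
  simp only [taskCost, durAt_val]

/-- Consecutive precedence constraints become monotonicity since `rest k = dur k + rest (k + 1)`.
The two bounds come from the first and the last task, as `rest 0` is the total running time and
`rest n = 0`. -/
lemma Feasible.add_rest {σ : Fin I.n → ℕ} (hσ : I.Feasible σ) :
    Monotone (fun k => σ k + I.rest k) ∧ (∀ k, I.before I.n ≤ σ k + I.rest k) ∧
      ∀ k, σ k + I.rest k ≤ I.boundary I.J := by
  have hr : ∀ k : Fin I.n, I.rest k = I.dur k + I.rest (k + 1) := fun k => by
    rw [I.rest_eq k.2, durAt_val]
  have step : ∀ k : ℕ, (hk : k + 1 < I.n) →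
      σ ⟨k, by omega⟩ + I.rest k ≤ σ ⟨k + 1, hk⟩ + I.rest (k + 1) := by
    intro k hk
    have h1 := hσ.1 ⟨k, by omega⟩ ⟨k + 1, hk⟩ (by simp)
    have h2 := hr ⟨k, by omega⟩
    dsimp only at h2
    omega
  have mono : Monotone (fun k => σ k + I.rest k) := by
    have aux : ∀ m k : ℕ, (hm : k + m < I.n) →
        σ ⟨k, by omega⟩ + I.rest k ≤ σ ⟨k + m, hm⟩ + I.rest (k + m) := by
      intro m
      induction m with
      | zero => intro k _; exact le_rfl
      | succ m ih => intro k hm; exact (ih k (by omega)).trans (step (k + m) hm)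
    rintro ⟨k, hk⟩ ⟨l, hl⟩ hkl
    obtain ⟨m, rfl⟩ := Nat.exists_eq_add_of_le (show k ≤ l from hkl)
    exact aux m k _
  refine ⟨mono, fun k => ?_, fun k => ?_⟩
  · have h0 : 0 < I.n := k.pos
    have := mono (show (⟨0, h0⟩ : Fin I.n) ≤ k from Nat.zero_le _)
    have h3 : I.rest 0 = I.before I.n := by simp [rest, before]
    dsimp only at this ⊢
    omega
  · have h0 : I.n - 1 < I.n := by have := k.pos; omega
    have := mono (show k ≤ ⟨I.n - 1, h0⟩ from Nat.le_sub_one_of_lt k.2)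
    have h3 := hr ⟨I.n - 1, h0⟩
    have h4 := hσ.2 ⟨I.n - 1, h0⟩
    have h5 : I.rest (I.n - 1 + 1) = 0 := by rw [Nat.sub_add_cancel (by omega)]; simp [rest]
    rw [T_eq] at h4
    dsimp only at *
    omega

end

lemma monotone_cand_path : Monotone fun k : Fin I.n => I.cand (I.path (I.n - k)) :=
  fun _ _ h => MonotoneDP.apply_path_le _ _ _ (Nat.sub_le_sub_left h _)

theorem exists_feasible_iff : (∃ σ, I.Feasible σ) ↔ I.before I.n ≤ I.boundary I.J :=
  ⟨fun ⟨_, h⟩ => I.before_le_T h, fun h => ⟨_, feasible_sub_rest I.monotone_cand_path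
    (fun _ => before_le_cand _) fun _ => cand_le h _⟩⟩

theorem optimal_startTime (h : I.before I.n ≤ I.boundary I.J) :
    I.Optimal fun k => I.startTime k := by
  have hx := I.monotone_cand_path
  refine ⟨feasible_sub_rest hx (fun _ => before_le_cand _) fun _ => cand_le h _, fun τ hτ => ?_⟩
  have hopt := cost_sub_rest hx (fun _ => before_le_cand _) fun _ => cand_le h _
  obtain ⟨m, l, u⟩ := hτ.add_rest
  -- The competitor `τ`, in shifted coordinates, is rounded to breakpoints; the endpoints of the
  -- range are the breakpoints of the pairs (0, 0) and (J, n).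
  obtain ⟨y, hy, hyC, hle⟩ := exists_rounding
    (a := I.before I.n) (b := I.boundary I.J) (C := I.breakpoints)
    (by simpa [boundary, rest, before] using I.mem_breakpoints (Nat.zero_le _) (Nat.zero_le _))
    (by simpa [rest] using I.mem_breakpoints le_rfl le_rfl)
    (fun k => I.taskCost k) (by
      intro k c _ c' _ v hac hcv hvc hC
      have := I.affineOnIcc_taskCost k.2 hac hC v hcv hvc
      zify [hcv, hvc, hcv.trans hvc]
      exact this) _ m l u
  have hτ' : I.cost τ = I.baseCost + ∑ k : Fin I.n, I.taskCost k (τ k + I.rest k) := by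
    rw [← cost_sub_rest m l u]
    simp
  choose z hz hzy using fun k => I.exists_cand (hyC k).1 (hyC k).2.1 (hyC k).2.2
  have hdp := MonotoneDP.sum_path_le (M := I.numCand) I.cand I.taskCost I.n
    (fun i => if h : i < I.n then z ⟨i, h⟩ else 0)
    (fun i hi => by simpa [hi] using hz _)
    (fun i hi => by
      simp only [show i < I.n by omega, hi, dif_pos, hzy]
      exact hy (by simp))
    (fun i hi => by rw [I.cand_last h]; exact cand_le h _)
  rw [← Fin.sum_univ_eq_sum_range (fun i => I.taskCost i (I.cand (MonotoneDP.path _ _ _ _ _))),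
    ← Fin.sum_univ_eq_sum_range (fun i => I.taskCost i (I.cand _))] at hdp
  simp only [Fin.is_lt, dif_pos, Fin.eta, hzy] at hdp
  rw [hτ']
  refine hopt.le.trans ?_
  exact Nat.add_le_add_left (hdp.trans hle) _

end CarbonInstance

/-! ## Rules for statements -/

namespace Ram.Stm

variable {ι : Type} [DecidableEq ι] {V N : ℕ}

/-- Safety and the invariant are obtained together, since the safety of a round rests on the
invariant before it. The step also receives the values of all variables that the body keeps, so
`Inv` need not mention them. -/
lemma forTo_rule (Inv : ℕ → Store ι → Prop) {x y : ι} {p : Stm ι} {s : Store ι} (hV : 1 < V)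
    (hN : s.var y ≤ N) (h0 : Inv 0 (s.setVar x 0))
    (hstep : ∀ i < s.var y, ∀ t : Store ι, t.var x = i →
      (∀ z, z ≠ x → p.Keeps z → t.var z = s.var z) → Inv i t →
        p.Safe V N t ∧ Inv (i + 1) ((p.exec t).setVar x (i + 1))) :
    (forTo x y p).Safe V N s ∧ Inv (s.var y) ((forTo x y p).exec s) := by
  have key : ∀ i ≤ s.var y, Inv i (iter p.exec x s i) := by
    intro i
    induction i with
    | zero => exact fun _ => h0
    | succ i ih => exact fun hi => (hstep i (by omega) _ (iter_var_self _ _ _ _)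
        (fun z hz hp => iter_var hz (p.exec_var hp) _ _) (ih (by omega))).2
  exact ⟨⟨hV, hN, fun i hi => (hstep i hi _ (iter_var_self _ _ _ _)
    (fun z hz hp => iter_var hz (p.exec_var hp) _ _) (key i hi.le)).1⟩, key _ le_rfl⟩

end Ram.Stm

/-- The memory `m` with the values `f 0, …, f (k - 1)` in the cells from `b` on. -/
def overlay (m : ℕ → ℕ) (b k : ℕ) (f : ℕ → ℕ) (a : ℕ) : ℕ :=
  if b ≤ a ∧ a < b + k then f (a - b) else m a

section overlay

variable {m : ℕ → ℕ} {b k : ℕ} {f : ℕ → ℕ}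

lemma overlay_add {i : ℕ} (hi : i < k) : overlay m b k f (b + i) = f i := by
  simp [overlay, hi]

lemma overlay_of_not {a : ℕ} (h : a < b ∨ b + k ≤ a) : overlay m b k f a = m a := by
  rw [overlay, if_neg (by omega)]

lemma overlay_zero : overlay m b 0 f = m :=
  funext fun _ => overlay_of_not (by omega)

lemma update_overlay {a : ℕ} (ha : a = b + k) :
    Function.update (overlay m b k f) a (f k) = overlay m b (k + 1) f := by
  subst ha
  funext x
  by_cases hx : x = b + k
  · subst hx; simp [overlay]
  · rw [Function.update_of_ne hx, overlay, overlay]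
    split_ifs <;> first | rfl | omega

lemma overlay_congr {f' : ℕ → ℕ} (h : ∀ i < k, f i = f' i) : overlay m b k f = overlay m b k f' := by
  funext a
  rw [overlay, overlay]
  split_ifs with ha
  · exact h _ (by omega)
  · rfl

lemma overlay_eq_self (h : ∀ i < k, m (b + i) = f i) : overlay m b k f = m := by
  funext a
  rw [overlay]
  split_ifs with ha
  · rw [← h _ (by omega), Nat.add_sub_cancel' ha.1]
  · rfl

end overlay

namespace CarbonInstance

open Ram Ram.Stm Ram.Expr

/-! ## The program -/

/-- The variables of the program. The names in `base` stand for the addresses of arrays: running times, lengths,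
green budgets, boundaries, prefix sums of running times, candidate points, and the table. -/
inductive Var where
  | n | J | idle | work | J1 | n1 | cands
  | baseD | baseL | baseG | baseE | baseP | baseX | baseF
  | total | deadline
  | i | j | k | c | b | c' | x | lo | hi | g | row
  deriving DecidableEq

instance : Finite Var :=
  Set.finite_univ_iff.1 ((List.finite_toSet [.n, .J, .idle, .work, .J1, .n1, .cands, .baseD,
    .baseL, .baseG, .baseE, .baseP, .baseX, .baseF, .total, .deadline, .i, .j, .k, .c, .b, .c', .x,
    .lo, .hi, .g, .row]).subset fun z _ => by cases z <;> simp)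

infixr:60 " ;; " => Stm.seq

/-- The expression that reads the entry `i` of the array with address `a`. -/
def entry (a : Var) (i : Expr Var) : Expr Var := load (var a + i)

/-- Read the parameters and lay out the memory. -/
def setup : Stm Var :=
  assign .n (load 0) ;; assign .J (load 1) ;; assign .idle (load 2) ;; assign .work (load 3) ;;
  assign .J1 (var .J + 1) ;; assign .n1 (var .n + 1) ;; assign .cands (var .J1 * var .n1) ;;
  assign .baseD 4 ;; assign .baseL (var .baseD + var .n) ;;
  assign .baseG (var .baseL + var .J) ;; assign .baseE (var .baseG + var .J) ;;
  assign .baseP (var .baseE + var .J1) ;; assign .baseX (var .baseP + var .n1) ;;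
  assign .baseF (var .baseX + var .cands)

/-- Prefix sums of an array. -/
def prefixSums (len dst src : Var) : Stm Var :=
  -- Entry 0 of the destination is not written: memory beyond the input is already 0.
  forTo .i len (store (var dst + var .i + 1) (entry dst (var .i) + entry src (var .i)))

/-- Compute the candidate points. -/
def fillCand : Stm Var :=
  forTo .j .J1 (forTo .i .n1
    (assign .x (entry .baseE (var .j) + (var .total - entry .baseP (var .i))) ;;
      store (var .baseX + (var .j * var .n1 + var .i))
        -- With truncated subtraction, a - (a - b) is the minimum and a + (b - a) the maximum of a
        -- and b.
        (var .total + (var .deadline - (var .deadline - var .x) - var .total))))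

/-- Compute the index of a minimum entry in a row of the table, among the candidate points up to
that with index `c`. -/
def findMin : Stm Var :=
  assign .b (var .c) ;;
  forTo .c' .cands
    -- A product expresses a conjunction: the first factor is nonzero when `c'` has a smaller entry
    -- than `b`, the second when its candidate point is at most that of `c`.
    (onlyIf ((entry .row (var .b) - entry .row (var .c')) *
      (1 - (entry .baseX (var .c') - entry .baseX (var .c)))) (assign .b (var .c')))

/-- Add the additional carbon cost of work between `lo` and `hi` to `g`. -/
def addExcess : Stm Var :=
  forTo .j .J (assign .g (var .g +
    ((var .idle + var .work - entry .baseG (var .j)) - (var .idle - entry .baseG (var .j))) *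
    ((var .hi - (var .hi - entry .baseE (var .j + 1))) -
      (var .lo + (entry .baseE (var .j) - var .lo)))))

/-- Compute one entry of the table. -/
def fillEntry : Stm Var :=
  findMin ;;
  assign .lo (entry .baseX (var .c) - (var .total - entry .baseP (var .k))) ;;
  assign .hi (var .lo + entry .baseD (var .k)) ;;
  assign .g (entry .row (var .b)) ;;
  addExcess ;;
  -- `row` is the address of row `k`, so the new entry of row `k + 1` lies `cands` cells further on.
  store (var .row + var .cands + var .c) (var .g)

/-- Compute the table. -/
def fillTable : Stm Var :=
  -- Row 0 is identically zero, as is the untouched memory, so the first row written is row 1.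
  forTo .k .n (assign .row (var .baseF + var .k * var .cands) ;; forTo .c .cands fillEntry)

/-- Compute the start times, from the last task to the first. -/
def output : Stm Var :=
  -- This is 1 exactly when the total running time is at most the deadline, the feasibility
  -- criterion `exists_feasible_iff`.
  store 0 (1 - (var .total - var .deadline)) ;;
  assign .c (var .cands - 1) ;;
  forTo .i .n
    (assign .k (var .n - var .i) ;;
      assign .row (var .baseF + var .k * var .cands) ;;
      findMin ;;
      assign .c (var .b) ;;
      -- The start time of task `k - 1` goes into cell `k`. This may overwrite input cells, but all
      -- arrays still needed lie above address `n`.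
      store (var .k) (entry .baseX (var .c) - (var .total - entry .baseP (var .k - 1))))

/-- The program that computes an optimal schedule. -/
def scheduler : Stm Var :=
  setup ;; prefixSums .J .baseE .baseL ;; prefixSums .n .baseP .baseD ;;
  assign .total (entry .baseP (var .n)) ;; assign .deadline (entry .baseE (var .J)) ;;
  fillCand ;; fillTable ;; output

lemma wellFormed_scheduler : scheduler.WellFormed := by
  simp [scheduler, setup, prefixSums, fillCand, fillTable, fillEntry, addExcess, findMin, output,
    WellFormed, Keeps]

/-! ### Bounds -/

variable (I : CarbonInstance)

/-- A bound for all numbers that the program forms. -/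
def sizeBound : ℕ := 10 + 2 * I.n + 3 * I.J + I.numCand + (I.n + 1) * I.numCand + I.idle +
  I.work + 3 * I.before I.n + 2 * I.boundary I.J + (I.n + 1) * (I.work * I.boundary I.J)

lemma weight_le (j : ℕ) : I.weight j ≤ I.work := by unfold weight; omega

lemma sum_weight_le (lo hi m : ℕ) : ∑ j ∈ Finset.range m,
    I.weight j * (min hi (I.boundary (j + 1)) - max lo (I.boundary j)) ≤
      I.work * I.boundary m := by
  rw [boundary, Finset.mul_sum]
  refine Finset.sum_le_sum fun j _ => Nat.mul_le_mul (I.weight_le j) ?_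
  have := I.boundary_succ j
  omega

lemma table_bound (k c : ℕ) : I.table k c ≤ k * (I.work * I.boundary I.J) := by
  induction k generalizing c with
  | zero => simp [table, MonotoneDP.table]
  | succ k ih =>
    have h1 : I.taskCost k (I.cand c) ≤ _ := I.sum_weight_le _ _ I.J
    have h2 := ih (MonotoneDP.argmin I.cand (I.table k) c I.numCand)
    rw [add_mul, one_mul, add_comm (k * _)]
    exact Nat.add_le_add h1 h2

/-! ### Correctness of the program -/

/-- The variables that hold the parameters and the layout of the memory. -/
def params : List Var :=
  [.n, .J, .idle, .work, .J1, .n1, .cands, .baseD, .baseL, .baseG, .baseE, .baseP, .baseX, .baseF]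

/-- The parameters of the instance and the layout of the memory. -/
structure Layout (s : Store Var) : Prop where
  n : s.var .n = I.n
  J : s.var .J = I.J
  idle : s.var .idle = I.idle
  work : s.var .work = I.work
  J1 : s.var .J1 = I.J + 1
  n1 : s.var .n1 = I.n + 1
  cands : s.var .cands = I.numCand
  baseD : s.var .baseD = 4
  baseL : s.var .baseL = 4 + I.n
  baseG : s.var .baseG = 4 + I.n + I.J
  baseE : s.var .baseE = 4 + I.n + 2 * I.J
  baseP : s.var .baseP = 5 + I.n + 3 * I.J
  baseX : s.var .baseX = 6 + 2 * I.n + 3 * I.J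
  baseF : s.var .baseF = 6 + 2 * I.n + 3 * I.J + I.numCand

variable {I} {V N : ℕ} {s t : Store Var}

lemma Layout.congr (h : I.Layout s) (ht : ∀ z ∈ params, t.var z = s.var z) : I.Layout t := by
  simp only [params, List.forall_mem_cons, List.not_mem_nil, false_implies, implies_true,
    and_true] at ht
  obtain ⟨h1, h2, h3, h4, h5, h6, h7, h8, h9, h10, h11, h12, h13, h14⟩ := ht
  exact ⟨h1.trans h.n, h2.trans h.J, h3.trans h.idle, h4.trans h.work, h5.trans h.J1,
    h6.trans h.n1, h7.trans h.cands, h8.trans h.baseD, h9.trans h.baseL, h10.trans h.baseG,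
    h11.trans h.baseE, h12.trans h.baseP, h13.trans h.baseX, h14.trans h.baseF⟩

lemma setVar_var (s : Store Var) (y z : Var) (v : ℕ) :
    (s.setVar y v).var z = if z = y then v else s.var z := by
  simp [Store.setVar, Function.update_apply]

variable (I) in
/-- The content of the memory that represents an instance. -/
def input : ℕ → ℕ := (Store.init (ι := Var) I.encode).mem

lemma input_scalars : I.input 0 = I.n ∧ I.input 1 = I.J ∧ I.input 2 = I.idle ∧
    I.input 3 = I.work := by
  simp [input, Store.init, encode]

lemma input_dur {k : ℕ} (hk : k < I.n) : I.input (4 + k) = I.durAt k := by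
  simp [input, Store.init, encode, add_comm 4, List.getElem?_append, hk, durAt]

lemma input_len {k : ℕ} (hk : k < I.J) : I.input (4 + I.n + k) = I.lenAt k := by
  rw [show 4 + I.n + k = I.n + k + 4 by omega]
  simp [input, Store.init, encode, List.getElem?_append, hk, lenAt]

lemma input_green {k : ℕ} (hk : k < I.J) : I.input (4 + I.n + I.J + k) = I.greenAt k := by
  rw [show 4 + I.n + I.J + k = I.n + (I.J + k) + 4 by omega]
  simp [input, Store.init, encode, hk, greenAt]

lemma input_of_le {a : ℕ} (ha : 4 + I.n + 2 * I.J ≤ a) : I.input a = 0 := by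
  have : I.encode.length ≤ a := by simp [encode]; omega
  simp [input, Store.init, this]

lemma setup_spec (hV : I.sizeBound < V) (hs : s.mem = I.input) :
    setup.Safe V N s ∧ I.Layout (setup.exec s) ∧ (setup.exec s).mem = I.input := by
  obtain ⟨h0, h1, h2, h3⟩ := I.input_scalars
  have hc : (I.J + 1) * (I.n + 1) = I.numCand := rfl
  refine ⟨?_, ?_, by simp [setup, exec, hs]⟩
  · simp only [sizeBound] at hV
    simp [setup, Stm.Safe, exec, setVar_var, hs, h0, h1, h2, h3, hc]
    omega
  · constructor <;> simp [setup, exec, setVar_var, hs, h0, h1, h2, h3, hc] <;> omega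

/-- The condition `S + m ≤ D` keeps the source array clear of the writes, so its entries can be read
from the initial memory in every round. -/
lemma prefixSums_spec {len dst src : Var} {D S m : ℕ} (hd : dst ≠ .i)
    (hsr : src ≠ .i) (h1 : s.var len = m) (h2 : s.var dst = D) (h3 : s.var src = S)
    (hSD : S + m ≤ D) (hD : s.mem D = 0) (hN : m ≤ N) (hV : D + m + 1 < V)
    (hsum : ∑ i ∈ Finset.range m, s.mem (S + i) < V) :
    (prefixSums len dst src).Safe V N s ∧ ((prefixSums len dst src).exec s).mem =
      overlay s.mem D (m + 1) fun k => ∑ i ∈ Finset.range k, s.mem (S + i) := by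
  rw [prefixSums]
  have key := forTo_rule (V := V) (N := N) (s := s) (x := .i) (y := len)
    (p := store (var dst + var .i + 1) (entry dst (var .i) + entry src (var .i)))
    (fun k t => t.mem = overlay s.mem D (k + 1) fun k => ∑ i ∈ Finset.range k, s.mem (S + i))
    (by omega) (by omega) ?_ ?_
  · rw [h1] at key; exact key
  · exact (overlay_eq_self fun i hi => by simp [show i = 0 by omega, hD]).symm
  · intro i hi t hx hf ht
    have e1 : t.var dst = D := (hf _ hd trivial).trans h2
    have e2 : t.var src = S := (hf _ hsr trivial).trans h3
    have r1 : t.mem (D + i) = ∑ l ∈ Finset.range i, s.mem (S + l) := by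
      rw [ht, overlay_add (by omega)]
    have r2 : t.mem (S + i) = s.mem (S + i) := by rw [ht, overlay_of_not (by omega)]
    have r3 := Finset.sum_range_succ (fun l => s.mem (S + l)) i
    have r4 : ∑ l ∈ Finset.range (i + 1), s.mem (S + l) ≤ _ := Finset.sum_le_sum_of_subset
      (Finset.range_subset_range.2 (show i + 1 ≤ m by omega))
    constructor
    · simp [Stm.Safe, entry, e1, e2, hx, r1, r2]
      omega
    · simp only [exec, entry, eval_add, eval_var, eval_load, eval_ofNat, e1, e2, hx, r1, r2,
        Store.setVar_mem, Store.setMem_mem, ← r3]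
      rw [ht]
      exact update_overlay (f := fun k => ∑ i ∈ Finset.range k, s.mem (S + i)) (by omega)

variable (I) in
/-- The input, the boundaries, the prefix sums of the running times, and the candidate points. -/
def arrays : ℕ → ℕ :=
  overlay (overlay (overlay I.input (4 + I.n + 2 * I.J) (I.J + 1) I.boundary)
    (5 + I.n + 3 * I.J) (I.n + 1) I.before) (6 + 2 * I.n + 3 * I.J) I.numCand I.cand

variable (I) in
/-- The arrays and the first `r` entries of the table. -/
def tableMem (r : ℕ) : ℕ → ℕ :=
  overlay I.arrays (6 + 2 * I.n + 3 * I.J + I.numCand) r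
    fun a => I.table (a / I.numCand) (a % I.numCand)

/-- The memory contains the arrays. -/
structure HasArrays (I : CarbonInstance) (m : ℕ → ℕ) : Prop where
  dur : ∀ k < I.n, m (4 + k) = I.durAt k
  green : ∀ j < I.J, m (4 + I.n + I.J + j) = I.greenAt j
  boundary : ∀ j ≤ I.J, m (4 + I.n + 2 * I.J + j) = I.boundary j
  before : ∀ k ≤ I.n, m (5 + I.n + 3 * I.J + k) = I.before k
  cand : ∀ c < I.numCand, m (6 + 2 * I.n + 3 * I.J + c) = I.cand c

lemma hasArrays_tableMem (r : ℕ) : I.HasArrays (I.tableMem r) := by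
  constructor
  · intro k hk
    rw [tableMem, overlay_of_not (by omega), arrays, overlay_of_not (by omega),
      overlay_of_not (by omega), overlay_of_not (by omega), input_dur hk]
  · intro k hk
    rw [tableMem, overlay_of_not (by omega), arrays, overlay_of_not (by omega),
      overlay_of_not (by omega), overlay_of_not (by omega), input_green hk]
  · intro k hk
    rw [tableMem, overlay_of_not (by omega), arrays, overlay_of_not (by omega),
      overlay_of_not (by omega), overlay_add (by omega)]
  · intro k hk
    rw [tableMem, overlay_of_not (by omega), arrays, overlay_of_not (by omega),
      overlay_add (by omega)]
  · intro k hk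
    rw [tableMem, overlay_of_not (by omega), arrays, overlay_add hk]

lemma tableMem_first : I.tableMem I.numCand = I.arrays := by
  refine overlay_eq_self fun i hi => ?_
  rw [arrays, overlay_of_not (by omega), overlay_of_not (by omega), overlay_of_not (by omega),
    input_of_le (by omega), Nat.div_eq_of_lt hi]
  rfl

lemma tableMem_row {r k c : ℕ} (hc : c < I.numCand) (hr : k * I.numCand + c < r) :
    I.tableMem r (6 + 2 * I.n + 3 * I.J + I.numCand + k * I.numCand + c) = I.table k c := by
  rw [tableMem, add_assoc _ (k * _), overlay_add hr, mul_comm, Nat.mul_add_div (by omega),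
    Nat.mul_add_mod, Nat.div_eq_of_lt hc, Nat.mod_eq_of_lt hc, add_zero]

lemma mul_add_lt {a b c M : ℕ} (ha : a < b) (hc : c < M) : a * M + c < b * M := by
  have := Nat.mul_le_mul_right M (show a + 1 ≤ b from ha)
  rw [add_mul, one_mul] at this
  omega

lemma fillCand_spec (hV : I.sizeBound < V) (hN : I.J + 1 ≤ N) (hN' : I.n + 1 ≤ N)
    (hs : I.Layout s) (hT : s.var .deadline = I.boundary I.J) (hP : s.var .total = I.before I.n)
    (hm : s.mem = overlay (overlay I.input (4 + I.n + 2 * I.J) (I.J + 1) I.boundary)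
      (5 + I.n + 3 * I.J) (I.n + 1) I.before) :
    fillCand.Safe V N s ∧ (fillCand.exec s).mem = I.arrays := by
  set m := overlay (overlay I.input (4 + I.n + 2 * I.J) (I.J + 1) I.boundary)
      (5 + I.n + 3 * I.J) (I.n + 1) I.before with hm0
  simp only [sizeBound] at hV
  have key := forTo_rule (V := V) (N := N) (s := s) (x := .j) (y := .J1)
    (p := forTo .i .n1
      (assign .x (entry .baseE (var .j) + (var .total - entry .baseP (var .i))) ;;
      store (var .baseX + (var .j * var .n1 + var .i))
        (var .total + (var .deadline - (var .deadline - var .x) - var .total))))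
    (fun j t => t.mem = overlay m (6 + 2 * I.n + 3 * I.J) (j * (I.n + 1)) I.cand)
    (by omega) (by rw [hs.J1]; exact hN) (by simp [overlay_zero, hm]) ?_
  · rw [hs.J1] at key
    exact key
  · intro j hj t hjt hf ht
    rw [hs.J1] at hj
    have hlt : I.Layout t := hs.congr fun z hz => hf z (by rintro rfl; simp [params] at hz)
      (by simp only [Keeps]; revert z; simp [params])
    have hTt : t.var .deadline = I.boundary I.J := (hf _ (by simp) (by simp [Keeps])).trans hT
    have hPt : t.var .total = I.before I.n := (hf _ (by simp) (by simp [Keeps])).trans hP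
    have key := forTo_rule (V := V) (N := N) (s := t) (x := .i) (y := .n1)
      (p := assign .x (entry .baseE (var .j) + (var .total - entry .baseP (var .i))) ;;
        store (var .baseX + (var .j * var .n1 + var .i))
        (var .total + (var .deadline - (var .deadline - var .x) - var .total)))
      (fun i t => t.mem = overlay m (6 + 2 * I.n + 3 * I.J) (j * (I.n + 1) + i) I.cand)
      (by omega) (by rw [hlt.n1]; exact hN') (by simpa using ht) ?_
    · rw [hlt.n1] at key
      refine ⟨key.1, ?_⟩
      rw [Store.setVar_mem, key.2, add_mul, one_mul]
    · intro i hi u hiu hg hu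
      rw [hlt.n1] at hi
      have hlu : I.Layout u := hlt.congr fun z hz => hg z (by rintro rfl; simp [params] at hz)
        (by simp only [Keeps]; revert z; simp [params])
      have hTu : u.var .deadline = I.boundary I.J := (hg _ (by simp) (by simp [Keeps])).trans hTt
      have hPu : u.var .total = I.before I.n := (hg _ (by simp) (by simp [Keeps])).trans hPt
      have hju : u.var .j = j := (hg _ (by simp) (by simp [Keeps])).trans hjt
      have hlt : j * (I.n + 1) + i < I.numCand := mul_add_lt hj hi
      have r1 : u.mem (4 + I.n + 2 * I.J + j) = I.boundary j := by
        rw [hu, overlay_of_not (by omega), hm0, overlay_of_not (by omega), overlay_add hj]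
      have r2 : u.mem (5 + I.n + 3 * I.J + i) = I.before i := by
        rw [hu, overlay_of_not (by omega), hm0, overlay_add hi]
      have b1 := I.boundary_mono (show j ≤ I.J by omega)
      have b2 := I.cand_eq j (show i ≤ I.n by omega)
      rw [rest] at b2
      constructor
      · simp [Stm.Safe, exec, setVar_var, entry, hTu, hPu, hju, hiu, hlu.baseE, hlu.baseP,
          hlu.baseX, hlu.n1, r1, r2]
        omega
      · simp only [exec, setVar_var, entry, eval_add, eval_sub, eval_mul, eval_var, eval_load,
          Store.setVar_mem, Store.setMem_mem, hTu, hPu, hju, hiu, hlu.baseE, hlu.baseP,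
          hlu.baseX, hlu.n1, r1, r2, reduceCtorEq, if_true, if_false]
        rw [hu, ← add_assoc (j * _), ← update_overlay rfl]
        congr 1
        omega

lemma findMin_spec (hV : I.sizeBound < V) (hN : I.numCand ≤ N) (hs : I.Layout s)
    (ha : ∀ c < I.numCand, s.mem (6 + 2 * I.n + 3 * I.J + c) = I.cand c) {c k r : ℕ} (hc : s.var .c = c) (hcM : c < I.numCand)
    (hr : s.var .row = r) (hrV : r + I.numCand ≤ I.sizeBound)
    (hrow : ∀ b < I.numCand, s.mem (r + b) = I.table k b) (hk : k ≤ I.n) :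
    findMin.Safe V N s ∧ (findMin.exec s).mem = s.mem ∧
      (findMin.exec s).var .b = MonotoneDP.argmin I.cand (I.table k) c I.numCand := by
  have hF : ∀ b, I.table k b ≤ (I.n + 1) * (I.work * I.boundary I.J) := fun b =>
    (I.table_bound k b).trans (Nat.mul_le_mul_right _ (by omega))
  have hV' := hV
  simp only [sizeBound] at hV'
  have key := forTo_rule (V := V) (N := N) (s := s.setVar .b c) (x := .c') (y := .cands)
    (p := onlyIf ((entry .row (var .b) - entry .row (var .c')) *
      (1 - (entry .baseX (var .c') - entry .baseX (var .c)))) (assign .b (var .c')))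
    (fun i t => t.mem = s.mem ∧ t.var .b = MonotoneDP.argmin I.cand (I.table k) c i)
    (by omega) (by simpa [setVar_var, hs.cands] using hN)
    (by simp [setVar_var, MonotoneDP.argmin]) ?_
  · simp only [setVar_var, hs.cands, reduceCtorEq, if_false] at key
    have e : findMin.exec s = (forTo .c' .cands
      (onlyIf ((entry .row (var .b) - entry .row (var .c')) *
      (1 - (entry .baseX (var .c') - entry .baseX (var .c)))) (assign .b (var .c')))).exec
        (s.setVar .b c) := by rw [← hc]; rfl
    rw [e]
    refine ⟨⟨trivial, ?_⟩, key.2⟩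
    simpa [exec, hc] using key.1
  · intro i hi t hit hf ht
    simp only [setVar_var, hs.cands, reduceCtorEq, if_false] at hi
    obtain ⟨hm, hb⟩ := ht
    have e1 : t.var .c = c := by
      rw [hf _ (by simp) (by simp [Keeps])]; simpa [setVar_var] using hc
    have e2 : t.var .row = r := by
      rw [hf _ (by simp) (by simp [Keeps])]; simpa [setVar_var] using hr
    have e3 : t.var .baseX = 6 + 2 * I.n + 3 * I.J := by
      rw [hf _ (by simp) (by simp [Keeps])]; simpa [setVar_var] using hs.baseX
    have hbM := MonotoneDP.argmin_lt I.cand (I.table k) c i hcM hi.le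
    have r1 : t.mem (r + t.var .b) = I.table k (t.var .b) := by
      rw [hm, hb, hrow _ hbM]
    have r2 : t.mem (r + i) = I.table k i := by rw [hm, hrow _ hi]
    have r3 : t.mem (6 + 2 * I.n + 3 * I.J + i) = I.cand i := by rw [hm, ha _ hi]
    have r4 : t.mem (6 + 2 * I.n + 3 * I.J + c) = I.cand c := by rw [hm, ha _ hcM]
    have h1 : (I.table k (t.var .b) - I.table k i) * (1 - (I.cand i - I.cand c)) < V := by
      refine (Nat.mul_le_mul_left _ (Nat.sub_le _ _)).trans_lt ?_
      have := hF (t.var .b)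
      omega
    -- The tested product is nonzero exactly under the condition by which `argmin` replaces its
    -- current index.
    have h2 : (I.table k (t.var .b) - I.table k i) * (1 - (I.cand i - I.cand c)) = 0 ↔
        ¬ (I.cand i ≤ I.cand c ∧ I.table k i < I.table k (t.var .b)) := by
      rw [mul_eq_zero]
      omega
    have hev : ((entry .row (var .b) - entry .row (var .c')) *
        (1 - (entry .baseX (var .c') - entry .baseX (var .c)))).eval t =
        (I.table k (t.var .b) - I.table k i) * (1 - (I.cand i - I.cand c)) := by
      simp [entry, e1, e2, e3, hit, r1, r2, r3, r4]
    rw [← hb] at hbM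
    constructor
    · refine ⟨?_, fun _ => trivial⟩
      simp [entry, e1, e2, e3, hit, r1, r2, r3, r4, h1]
      omega
    · rw [exec, hev, MonotoneDP.argmin, ← hb]
      simp only [h2]
      by_cases hcond : I.cand i ≤ I.cand c ∧ I.table k i < I.table k (t.var .b)
      · simp [hcond, exec, setVar_var, hit, hm]
      · simp [hcond, setVar_var, hm]

lemma addExcess_spec (hV : I.sizeBound < V) (hN : I.J ≤ N) (hs : I.Layout s)
    (ha : I.HasArrays s.mem) {k lo hi g : ℕ} (hlo : s.var .lo = lo) (hhi : s.var .hi = hi)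
    (hloV : lo + I.boundary I.J < V) (hg : s.var .g = g)
    (hgk : g ≤ k * (I.work * I.boundary I.J)) (hk : k ≤ I.n) :
    addExcess.Safe V N s ∧ (addExcess.exec s).var .g = g + I.excess lo hi := by
  have hgk' : g + I.work * I.boundary I.J ≤ (I.n + 1) * (I.work * I.boundary I.J) := by
    rw [add_mul, one_mul]
    exact Nat.add_le_add_right (hgk.trans (Nat.mul_le_mul_right _ hk)) _
  have hsum : ∀ m ≤ I.J, ∑ j ∈ Finset.range m,
      I.weight j * (min hi (I.boundary (j + 1)) - max lo (I.boundary j)) ≤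
        I.work * I.boundary I.J := fun m hm =>
    (I.sum_weight_le lo hi m).trans (Nat.mul_le_mul_left _ (I.boundary_mono hm))
  simp only [sizeBound] at hV
  have key := forTo_rule (V := V) (N := N) (s := s) (x := .j) (y := .J)
    (p := assign .g (var .g +
    ((var .idle + var .work - entry .baseG (var .j)) - (var .idle - entry .baseG (var .j))) *
    ((var .hi - (var .hi - entry .baseE (var .j + 1))) -
      (var .lo + (entry .baseE (var .j) - var .lo)))))
    (fun i t => t.mem = s.mem ∧ t.var .g = g + ∑ j ∈ Finset.range i,
      I.weight j * (min hi (I.boundary (j + 1)) - max lo (I.boundary j)))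
    (by omega) (by rw [hs.J]; exact hN) (by simp [setVar_var, hg]) ?_
  · rw [hs.J] at key
    exact ⟨key.1, key.2.2⟩
  · intro j hj t hjt hf ht
    obtain ⟨hm, htg⟩ := ht
    rw [hs.J] at hj
    have hlt : I.Layout t := hs.congr fun z hz => hf z (by rintro rfl; simp [params] at hz)
      (by simp only [Keeps]; rintro rfl; simp [params] at hz)
    have e1 : t.var .lo = lo := (hf _ (by simp) (by simp [Keeps])).trans hlo
    have e2 : t.var .hi = hi := (hf _ (by simp) (by simp [Keeps])).trans hhi
    have r1 := ha.green j hj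
    have r2 := ha.boundary j hj.le
    have r3 := ha.boundary (j + 1) hj
    have b1 := I.boundary_mono hj.le
    have b2 := hsum (j + 1) hj
    rw [Finset.sum_range_succ] at b2
    rw [← hm] at r1 r2 r3
    have hw : I.idle + I.work - I.greenAt j - (I.idle - I.greenAt j) = I.weight j := rfl
    have ho : hi - (hi - I.boundary (j + 1)) - (lo + (I.boundary j - lo)) =
        min hi (I.boundary (j + 1)) - max lo (I.boundary j) := by omega
    constructor
    · simp [Stm.Safe, entry, e1, e2, hjt, hlt.idle, hlt.work, hlt.baseG, hlt.baseE, r1, r2, r3,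
        hw, ho, htg]
      omega
    · refine ⟨hm, ?_⟩
      rw [Finset.sum_range_succ, ← add_assoc, ← htg]
      simp [exec, entry, e1, e2, hjt, hlt.idle, hlt.work, hlt.baseG, hlt.baseE, r1,
        r2, r3, hw, ho, setVar_var]

lemma row_le {k : ℕ} (hk : k < I.n) :
    k * I.numCand + I.numCand + I.numCand ≤ (I.n + 1) * I.numCand := by
  have := Nat.mul_le_mul_right I.numCand (show k + 1 + 1 ≤ I.n + 1 by omega)
  rwa [add_mul, add_mul, one_mul] at this

lemma fillEntry_spec (hV : I.sizeBound < V) (hN : I.numCand ≤ N) (hN' : I.J ≤ N)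
    (hs : I.Layout s) (hP : s.var .total = I.before I.n)
    {c k : ℕ} (hc : s.var .c = c) (hcM : c < I.numCand) (hk : s.var .k = k) (hkn : k < I.n)
    (hr : s.var .row = 6 + 2 * I.n + 3 * I.J + I.numCand + k * I.numCand)
    (hm : s.mem = I.tableMem ((k + 1) * I.numCand + c)) :
    fillEntry.Safe V N s ∧ (fillEntry.exec s).mem = I.tableMem ((k + 1) * I.numCand + (c + 1)) := by
  have hadd : (k + 1) * I.numCand = k * I.numCand + I.numCand := by rw [add_mul, one_mul]
  have hrow := row_le hkn
  have hdiv : ((k + 1) * I.numCand + c) / I.numCand = k + 1 := by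
    rw [mul_comm, Nat.mul_add_div (by omega), Nat.div_eq_of_lt hcM, add_zero]
  have hmod : ((k + 1) * I.numCand + c) % I.numCand = c := by
    rw [mul_comm, Nat.mul_add_mod, Nat.mod_eq_of_lt hcM]
  have ha : I.HasArrays s.mem := hm ▸ hasArrays_tableMem _
  have hT : ∀ b < I.numCand, s.mem (6 + 2 * I.n + 3 * I.J + I.numCand + k * I.numCand + b) =
      I.table k b := fun b hb => by rw [hm, tableMem_row hb (by omega)]
  have hF := I.table_bound k (MonotoneDP.argmin I.cand (I.table k) c I.numCand)
  obtain ⟨f1, f2, f3⟩ := findMin_spec hV hN hs ha.cand hc hcM hr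
    (by unfold sizeBound; omega) hT hkn.le
  set s₁ := findMin.exec s with hs₁
  have fr : ∀ z, findMin.Keeps z → s₁.var z = s.var z := fun z hz => exec_var _ hz _
  have l₁ : I.Layout s₁ := hs.congr fun z hz => fr z (by revert z; simp [params, findMin, Keeps])
  have a₁ : I.HasArrays s₁.mem := f2 ▸ ha
  have e1 : s₁.var .c = c := (fr _ (by simp [findMin, Keeps])).trans hc
  have e2 : s₁.var .k = k := (fr _ (by simp [findMin, Keeps])).trans hk
  have e3 : s₁.var .total = I.before I.n := (fr _ (by simp [findMin, Keeps])).trans hP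
  have e4 : s₁.var .row = _ := (fr _ (by simp [findMin, Keeps])).trans hr
  have r1 := a₁.cand c hcM
  have r2 := a₁.before k hkn.le
  have r3 := a₁.dur k hkn
  have r4 := hT _ (MonotoneDP.argmin_lt I.cand (I.table k) c I.numCand hcM le_rfl)
  rw [← f2, ← f3] at r4
  rw [← f3] at hF
  have b1 : I.cand c ≤ I.before I.n + I.boundary I.J := by unfold cand; omega
  have b2 := I.before_mono (show k + 1 ≤ I.n from hkn)
  rw [before_succ] at b2
  have hV' := hV
  simp only [sizeBound] at hV'
  -- The state on entry to `addExcess`: `g` starts from the best entry of row `k`, and the excess of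
  -- task `k` is then added to it.
  let s₄ := ((s₁.setVar .lo (I.cand c - I.rest k)).setVar .hi
    (I.cand c - I.rest k + I.durAt k)).setVar .g (I.table k (s₁.var .b))
  have l₄ : I.Layout s₄ := l₁.congr (by simp [params, s₄, setVar_var])
  obtain ⟨g1, g2⟩ := addExcess_spec (s := s₄) hV hN' l₄ a₁ (k := k) (lo := I.cand c - I.rest k)
    (hi := I.cand c - I.rest k + I.durAt k) (g := I.table k (s₁.var .b)) (by simp [s₄, setVar_var])
    (by simp [s₄, setVar_var]) (by omega) (by simp [s₄]) hF hkn.le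
  have m5 : (addExcess.exec s₄).mem = s.mem :=
    (exec_mem _ (by simp [addExcess, KeepsMem]) _).trans f2
  have fr₅ : ∀ z, addExcess.Keeps z → (addExcess.exec s₄).var z = s₄.var z :=
    fun z hz => exec_var _ hz _
  have v1 : (addExcess.exec s₄).var .row = _ := (fr₅ _ (by simp [addExcess, Keeps])).trans
    (show s₄.var .row = _ by simpa [s₄, setVar_var] using e4)
  have v2 : (addExcess.exec s₄).var .c = c := (fr₅ _ (by simp [addExcess, Keeps])).trans
    (show s₄.var .c = _ by simpa [s₄, setVar_var] using e1)
  have v3 : (addExcess.exec s₄).var .cands = I.numCand :=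
    (fr₅ _ (by simp [addExcess, Keeps])).trans l₄.cands
  have x1 : (assign .lo (entry .baseX (var .c) - (var .total - entry .baseP (var .k)))).exec s₁ =
      s₁.setVar .lo (I.cand c - I.rest k) := by
    simp [exec, entry, e1, e2, e3, l₁.baseX, l₁.baseP, r1, r2, rest]
  have x2 : (assign .hi (var .lo + entry .baseD (var .k))).exec
      (s₁.setVar .lo (I.cand c - I.rest k)) = (s₁.setVar .lo (I.cand c - I.rest k)).setVar .hi
        (I.cand c - I.rest k + I.durAt k) := by
    simp [exec, entry, setVar_var, e2, l₁.baseD, r3]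
  have x3 : (assign .g (entry .row (var .b))).exec
      ((s₁.setVar .lo (I.cand c - I.rest k)).setVar .hi (I.cand c - I.rest k + I.durAt k)) =
        s₄ := by
    simp [exec, entry, setVar_var, e4, r4, s₄]
  have hval : I.table k (s₁.var .b) + I.excess (I.cand c - I.rest k)
      (I.cand c - I.rest k + I.durAt k) = I.table (k + 1) c := by
    rw [f3, add_comm]; rfl
  constructor
  · simp only [fillEntry, Stm.Safe, ← hs₁, x1, x2, x3]
    refine ⟨f1, ?_, ?_, ?_, g1, ?_⟩
    · simp [entry, e1, e2, l₁.baseX, l₁.baseP]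
      omega
    · simp [entry, setVar_var, e2, l₁.baseD, r3]
      omega
    · simp [entry, setVar_var, e4, f3]
      have := MonotoneDP.argmin_lt I.cand (I.table k) c I.numCand hcM le_rfl
      omega
    · simp [v1, v2, v3]
      omega
  · simp only [fillEntry, exec_seq, ← hs₁, x1, x2, x3]
    rw [exec, Store.setMem_mem, m5, hm]
    simp only [eval_add, eval_var, v1, v2, v3, g2, hval]
    rw [← add_assoc, tableMem, tableMem, ← update_overlay rfl, hdiv, hmod]
    congr 1
    omega

lemma fillTable_spec (hV : I.sizeBound < V) (hN : I.numCand ≤ N) (hN' : I.J ≤ N) (hN'' : I.n ≤ N)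
    (hs : I.Layout s) (hP : s.var .total = I.before I.n) (hm : s.mem = I.arrays) :
    fillTable.Safe V N s ∧ (fillTable.exec s).mem = I.tableMem ((I.n + 1) * I.numCand) := by
  have hV' := hV
  simp only [sizeBound] at hV'
  have key := forTo_rule (V := V) (N := N) (s := s) (x := .k) (y := .n)
    (p := assign .row (var .baseF + var .k * var .cands) ;; forTo .c .cands fillEntry)
    (fun k t => t.mem = I.tableMem ((k + 1) * I.numCand))
    (by omega) (by rw [hs.n]; exact hN'')
    (by rw [zero_add, one_mul, tableMem_first]; exact hm) ?_
  · rw [hs.n] at key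
    exact key
  · intro k hk t hkt hf ht
    rw [hs.n] at hk
    have hrow := row_le hk
    have hlt : I.Layout t := hs.congr fun z hz => hf z (by rintro rfl; simp [params] at hz)
      (by revert z; simp [params, fillEntry, findMin, addExcess, Keeps])
    have hPt : t.var .total = I.before I.n :=
      (hf _ (by simp) (by simp [fillEntry, findMin, addExcess, Keeps])).trans hP
    set r := 6 + 2 * I.n + 3 * I.J + I.numCand + k * I.numCand with hr
    have hx : (assign .row (var .baseF + var .k * var .cands)).exec t = t.setVar .row r := by
      simp [exec, hlt.baseF, hkt, hlt.cands, hr]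
    have hlu : I.Layout (t.setVar .row r) := hlt.congr (by simp [params, setVar_var])
    have key := forTo_rule (V := V) (N := N) (s := t.setVar .row r) (x := .c) (y := .cands)
      (p := fillEntry) (fun c t => t.mem = I.tableMem ((k + 1) * I.numCand + c))
      (by omega) (by rw [hlu.cands]; exact hN) (by simpa using ht) ?_
    · rw [hlu.cands] at key
      simp only [Stm.Safe, exec_seq, hx, Store.setVar_mem, key.2]
      refine ⟨⟨?_, key.1⟩, by rw [add_mul (k + 1), one_mul]⟩
      simp [hlt.baseF, hkt, hlt.cands]
      omega
    · intro c hc u hcu hg hu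
      rw [hlu.cands] at hc
      have h1 : fillEntry.Keeps .k ∧ fillEntry.Keeps .row ∧ fillEntry.Keeps .total := by
        simp [fillEntry, findMin, addExcess, Keeps]
      exact fillEntry_spec hV hN hN' (hlu.congr fun z hz => hg z (by rintro rfl; simp [params] at hz)
        (by revert z; simp [params, fillEntry, findMin, addExcess, Keeps]))
        ((hg _ (by simp) h1.2.2).trans (by simpa [setVar_var] using hPt)) hcu hc
        ((hg _ (by simp) h1.1).trans (by simpa [setVar_var] using hkt)) hk
        ((hg _ (by simp) h1.2.1).trans (by simp [hr])) hu

variable (I) in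
/-- The table with the answer in the first cells, after the start times of the last `i` tasks have
been written. -/
def answerMem (i a : ℕ) : ℕ :=
  if a = 0 then 1 - (I.before I.n - I.boundary I.J)
  else if I.n < a + i ∧ a ≤ I.n then I.startTime (a - 1)
  else I.tableMem ((I.n + 1) * I.numCand) a

/-- The start times written so far do not disturb the prefix sums, candidate points and table from
which the remaining ones are computed. -/
lemma answerMem_of_lt {i a : ℕ} (ha : I.n < a) :
    I.answerMem i a = I.tableMem ((I.n + 1) * I.numCand) a := by
  rw [answerMem, if_neg (by omega), if_neg (by omega)]

lemma update_answerMem {i : ℕ} (hi : i < I.n) :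
    Function.update (I.answerMem i) (I.n - i) (I.startTime (I.n - i - 1)) =
      I.answerMem (i + 1) := by
  funext a
  by_cases ha : a = I.n - i
  · subst ha
    rw [Function.update_self, answerMem, if_neg (by omega), if_pos (by omega)]
  · rw [Function.update_of_ne ha, answerMem, answerMem]
    congr 1
    refine if_congr (by omega) rfl rfl

lemma output_spec (hV : I.sizeBound < V) (hN : I.numCand ≤ N) (hN' : I.n ≤ N)
    (hs : I.Layout s) (hP : s.var .total = I.before I.n) (hT : s.var .deadline = I.boundary I.J)
    (hm : s.mem = I.tableMem ((I.n + 1) * I.numCand)) :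
    output.Safe V N s ∧ (output.exec s).mem = I.answerMem I.n := by
  have hV' := hV
  simp only [sizeBound] at hV'
  have hpos := I.numCand_pos
  set s₂ := (s.setMem 0 (1 - (I.before I.n - I.boundary I.J))).setVar .c (I.numCand - 1) with hs₂
  have l₂ : I.Layout s₂ := hs.congr (by simp [params, s₂, setVar_var])
  have x1 : (store 0 (1 - (var .total - var .deadline))).exec s =
      s.setMem 0 (1 - (I.before I.n - I.boundary I.J)) := by simp [exec, hP, hT]
  have x2 : (assign .c (var .cands - 1)).exec
      (s.setMem 0 (1 - (I.before I.n - I.boundary I.J))) = s₂ := by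
    simp [exec, hs.cands, hs₂]
  have m₂ : s₂.mem = I.answerMem 0 := by
    simp only [hs₂, Store.setVar_mem, Store.setMem_mem, hm]
    funext a
    rw [answerMem, Function.update_apply, if_neg (show ¬ (I.n < a + 0 ∧ a ≤ I.n) by omega)]
  have key := forTo_rule (V := V) (N := N) (s := s₂) (x := .i) (y := .n)
    (p := assign .k (var .n - var .i) ;;
      assign .row (var .baseF + var .k * var .cands) ;;
      findMin ;;
      assign .c (var .b) ;;
      store (var .k) (entry .baseX (var .c) - (var .total - entry .baseP (var .k - 1))))
    (fun i t => t.mem = I.answerMem i ∧ t.var .c = I.path i)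
    (by omega) (by rw [l₂.n]; exact hN') ⟨m₂, by simp [hs₂, setVar_var]; rfl⟩ ?_
  · rw [l₂.n] at key
    simp only [output, Stm.Safe, exec_seq, x1, x2]
    refine ⟨⟨?_, ?_, key.1⟩, key.2.1⟩
    · simp; omega
    · simp; omega
  · intro i hi t hti hf ht
    obtain ⟨ht, htc⟩ := ht
    rw [l₂.n] at hi
    have hlt : I.Layout t := l₂.congr fun z hz => hf z (by rintro rfl; simp [params] at hz)
      (by revert z; simp [params, findMin, Keeps])
    have hPt : t.var .total = I.before I.n := by
      rw [hf _ (by simp) (by simp [findMin, Keeps])]; simpa [hs₂, setVar_var] using hP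
    have hrow : (I.n - i) * I.numCand + I.numCand ≤ (I.n + 1) * I.numCand := by
      have := Nat.mul_le_mul_right I.numCand (show I.n - i + 1 ≤ I.n + 1 by omega)
      rwa [add_mul, one_mul] at this
    have hread : ∀ a, I.n < a → t.mem a = I.tableMem ((I.n + 1) * I.numCand) a := fun a h => by
      rw [ht, answerMem_of_lt h]
    set r := 6 + 2 * I.n + 3 * I.J + I.numCand + (I.n - i) * I.numCand with hr
    set u := (t.setVar .k (I.n - i)).setVar .row r with hu
    have lu : I.Layout u := hlt.congr (by simp [params, hu, setVar_var])
    have hy : (assign .row (var .baseF + var .k * var .cands)).exec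
        ((assign .k (var .n - var .i)).exec t) = u := by
      simp [exec, setVar_var, hlt.n, hti, hlt.baseF, hlt.cands, hu, hr]
    have hcand : ∀ c < I.numCand, t.mem (6 + 2 * I.n + 3 * I.J + c) = I.cand c := fun c hc => by
      rw [hread _ (by omega), (hasArrays_tableMem _).cand c hc]
    have hc := MonotoneDP.path_lt I.cand I.taskCost hpos I.n i
    obtain ⟨f1, f2, f3⟩ := findMin_spec (k := I.n - i) (c := I.path i) (r := r) hV hN lu hcand
      (by simpa [hu, setVar_var] using htc) hc (by simp [hu])
      (by unfold sizeBound; omega)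
      (fun b hb => (hread _ (by omega)).trans (tableMem_row hb (by omega))) (by omega)
    set v := findMin.exec u with hv
    change v.var .b = I.path (i + 1) at f3
    have fr : ∀ z, findMin.Keeps z → v.var z = u.var z := fun z hz => exec_var _ hz _
    have lv : I.Layout v := lu.congr fun z hz => fr z (by revert z; simp [params, findMin, Keeps])
    have e1 : v.var .k = I.n - i := (fr _ (by simp [findMin, Keeps])).trans
      (by simp [hu, setVar_var])
    have e2 : v.var .total = I.before I.n := (fr _ (by simp [findMin, Keeps])).trans
      (by simpa [hu, setVar_var] using hPt)
    have hmv : v.mem = t.mem := f2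
    have r1 : v.mem (6 + 2 * I.n + 3 * I.J + I.path (i + 1)) = I.cand (I.path (i + 1)) := by
      rw [hmv]; exact hcand _ (MonotoneDP.path_lt I.cand I.taskCost hpos I.n (i + 1))
    have r2 : v.mem (5 + I.n + 3 * I.J + (I.n - i - 1)) = I.before (I.n - i - 1) := by
      rw [hmv, hread _ (by omega), (hasArrays_tableMem _).before _ (by omega)]
    have hlast := MonotoneDP.path_lt I.cand I.taskCost hpos I.n (i + 1)
    change I.path (i + 1) < _ at hlast
    have hst : I.cand (I.path (i + 1)) - (I.before I.n - I.before (I.n - i - 1)) =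
        I.startTime (I.n - i - 1) := by
      rw [startTime, rest, show I.n - (I.n - i - 1) = i + 1 by omega]
    simp only [Stm.Safe, exec_seq, hy, ← hv]
    refine ⟨⟨by simp, ?_, f1, by simp, ?_⟩, ?_, ?_⟩
    · simp [exec, setVar_var, hlt.n, hti, hlt.baseF, hlt.cands]
      omega
    · simp [exec, setVar_var, entry, e1, f3, lv.baseX, lv.baseP]
      omega
    · simp only [exec, entry, eval_add, eval_sub, eval_var, eval_load, eval_ofNat, setVar_var,
        Store.setVar_mem, Store.setMem_mem, reduceCtorEq, if_true, if_false, e1, e2, f3, lv.baseX,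
        lv.baseP, r1, r2, hst]
      rw [hmv, ht]
      exact update_answerMem hi
    · simp [exec, setVar_var, f3]

/-- The program takes the representation of an instance to a correct answer. -/
lemma scheduler_spec (hV : I.sizeBound < V) (hN : I.numCand ≤ N) :
    scheduler.Safe V N (Store.init I.encode) ∧
      (scheduler.exec (Store.init I.encode)).mem = I.answerMem I.n := by
  have hV' := hV
  simp only [sizeBound] at hV'
  have hcand : I.numCand = I.J * I.n + I.J + I.n + 1 := by unfold numCand; ring
  have hJN : I.J + 1 ≤ N := by have := Nat.zero_le (I.J * I.n); omega
  have hnN : I.n + 1 ≤ N := by have := Nat.zero_le (I.J * I.n); omega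
  obtain ⟨p1, l1, m1⟩ := setup_spec (N := N) (s := Store.init I.encode) hV rfl
  set s₁ := setup.exec (Store.init I.encode) with hs₁
  have sumL : ∀ k ≤ I.J, ∑ i ∈ Finset.range k, s₁.mem (4 + I.n + i) = I.boundary k :=
    fun k hk => Finset.sum_congr rfl fun i hi => by
      rw [m1, input_len ((Finset.mem_range.1 hi).trans_le hk)]
  obtain ⟨p2, m2⟩ := prefixSums_spec (s := s₁) (len := .J) (dst := .baseE) (src := .baseL)
    (V := V) (N := N) (by simp) (by simp) l1.J l1.baseE l1.baseL (by omega)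
    (by rw [m1, input_of_le le_rfl]) (by omega) (by omega) (by rw [sumL _ le_rfl]; omega)
  rw [overlay_congr fun k hk => sumL k (by omega), m1] at m2
  set s₂ := (prefixSums .J .baseE .baseL).exec s₁ with hs₂
  have l2 : I.Layout s₂ := l1.congr fun z hz => exec_var _
    (by revert z; simp [params, prefixSums, Keeps]) _
  have sumD : ∀ k ≤ I.n, ∑ i ∈ Finset.range k, s₂.mem (4 + i) = I.before k :=
    fun k hk => Finset.sum_congr rfl fun i hi => by
      have := (Finset.mem_range.1 hi).trans_le hk
      rw [m2, overlay_of_not (by omega), input_dur this]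
  obtain ⟨p3, m3⟩ := prefixSums_spec (s := s₂) (len := .n) (dst := .baseP) (src := .baseD)
    (V := V) (N := N) (by simp) (by simp) l2.n l2.baseP l2.baseD (by omega)
    (by rw [m2, overlay_of_not (by omega), input_of_le (by omega)]) (by omega) (by omega)
    (by rw [sumD _ le_rfl]; omega)
  rw [overlay_congr fun k hk => sumD k (by omega), m2] at m3
  set s₃ := (prefixSums .n .baseP .baseD).exec s₂ with hs₃
  have l3 : I.Layout s₃ := l2.congr fun z hz => exec_var _
    (by revert z; simp [params, prefixSums, Keeps]) _
  have r1 : s₃.mem (5 + I.n + 3 * I.J + I.n) = I.before I.n := by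
    rw [m3, overlay_add (by omega)]
  have r2 : s₃.mem (4 + I.n + 2 * I.J + I.J) = I.boundary I.J := by
    rw [m3, overlay_of_not (by omega), overlay_add (by omega)]
  set s₅ := (s₃.setVar .total (I.before I.n)).setVar .deadline (I.boundary I.J) with hs₅
  have x4 : (assign .total (entry .baseP (var .n))).exec s₃ = s₃.setVar .total (I.before I.n) := by
    simp [exec, entry, l3.baseP, l3.n, r1]
  have x5 : (assign .deadline (entry .baseE (var .J))).exec (s₃.setVar .total (I.before I.n)) =
      s₅ := by
    simp [exec, entry, setVar_var, l3.baseE, l3.J, r2, hs₅]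
  have l5 : I.Layout s₅ := l3.congr (by simp [params, hs₅, setVar_var])
  obtain ⟨p6, m6⟩ := fillCand_spec hV hJN hnN l5 (by simp [hs₅]) (by simp [hs₅, setVar_var]) m3
  set s₆ := fillCand.exec s₅ with hs₆
  have l6 : I.Layout s₆ := l5.congr fun z hz => exec_var _
    (by revert z; simp [params, fillCand, Keeps]) _
  have t6 : s₆.var .total = I.before I.n :=
    (exec_var _ (by simp [fillCand, Keeps]) _).trans (by simp [hs₅, setVar_var])
  have d6 : s₆.var .deadline = I.boundary I.J :=
    (exec_var _ (by simp [fillCand, Keeps]) _).trans (by simp [hs₅])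
  obtain ⟨p7, m7⟩ := fillTable_spec hV hN (by omega) (by omega) l6 t6 m6
  have k7 : ∀ z ∈ Var.total :: Var.deadline :: params, fillTable.Keeps z := by
    simp [params, fillTable, fillEntry, findMin, addExcess, Keeps]
  obtain ⟨p8, m8⟩ := output_spec hV hN (by omega)
    (l6.congr fun z hz => exec_var _ (k7 z (by simp [hz])) _)
    ((exec_var _ (k7 _ (by simp)) _).trans t6) ((exec_var _ (k7 _ (by simp)) _).trans d6) m7
  simp only [scheduler, Stm.Safe, exec_seq, ← hs₁, ← hs₂, ← hs₃, x4, x5, ← hs₆]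
  refine ⟨⟨p1, p2, p3, ?_, ?_, p6, p7, p8⟩, m8⟩
  · simp [entry, l3.baseP, l3.n]
    omega
  · simp [entry, setVar_var, l3.baseE, l3.J]
    omega

lemma correctAnswer_answerMem : I.CorrectAnswer (I.answerMem I.n) := by
  have hval : (fun i : Fin I.n => I.answerMem I.n (i + 1)) = fun i : Fin I.n => I.startTime i := by
    funext i
    rw [answerMem, if_neg (by omega), if_pos (by omega), Nat.add_sub_cancel]
  rw [CorrectAnswer, exists_feasible_iff, hval]
  refine ⟨fun h => ⟨?_, I.optimal_startTime h⟩, fun h => ?_⟩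
  · simp [answerMem]; omega
  · simp [answerMem]; omega

/-! ### Bounds in terms of the bit length -/

lemma sum_lt_two_pow_bitLength (l : List ℕ) : l.sum < 2 ^ bitLength l := by
  induction l with
  | nil => simp [bitLength]
  | cons x l ih =>
    have h1 : x < 2 ^ x.size := Nat.lt_size_self x
    have h2 : bitLength (x :: l) = x.size + 1 + bitLength l := by simp [bitLength]
    have h3 : 1 ≤ 2 ^ x.size := Nat.one_le_two_pow
    have h4 : 1 ≤ 2 ^ bitLength l := Nat.one_le_two_pow
    rw [h2, pow_add, pow_succ, List.sum_cons]
    -- The delimiter bit supplies the factor 2 in p + q ≤ 2pq for p, q ≥ 1.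
    nlinarith

lemma length_le_bitLength (l : List ℕ) : l.length ≤ bitLength l := by
  induction l with
  | nil => simp
  | cons x l ih => simp [bitLength] at *; omega

lemma encode_sum : I.encode.sum = I.n + I.J + I.idle + I.work + I.before I.n + I.boundary I.J +
    ∑ j, I.green j := by
  have h1 : I.before I.n = ∑ i, I.dur i := by
    simp only [before, ← Fin.sum_univ_eq_sum_range, durAt_val]
  rw [h1, ← T_eq, T]
  simp [encode, List.sum_ofFn]
  ring

lemma encode_length : I.encode.length = 4 + I.n + 2 * I.J := by
  simp [encode]
  omega

/-- With S = 2 ^ L, every term of `sizeBound` is a constant times a product of at most three factors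
S. Since L ≥ 4 gives S ≥ 16, one further factor S absorbs the constants. -/
lemma sizeBound_lt : I.sizeBound < 2 ^ (4 * bitLength I.encode) := by
  have h1 := sum_lt_two_pow_bitLength I.encode
  have h2 := length_le_bitLength I.encode
  rw [encode_sum] at h1
  rw [encode_length] at h2
  have h3 : 2 ^ 4 ≤ 2 ^ bitLength I.encode := Nat.pow_le_pow_right (by norm_num) (by omega)
  rw [mul_comm, pow_mul]
  set S := 2 ^ bitLength I.encode
  have a1 : I.numCand ≤ S * S := Nat.mul_le_mul (by omega) (by omega)
  have a2 : (I.n + 1) * I.numCand ≤ S * (S * S) := Nat.mul_le_mul (by omega) a1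
  have a3 : (I.n + 1) * (I.work * I.boundary I.J) ≤ S * (S * S) :=
    Nat.mul_le_mul (by omega) (Nat.mul_le_mul (by omega) (by omega))
  have a4 : 16 * S ≤ S * S := Nat.mul_le_mul_right _ h3
  have a5 : 16 * (S * S) ≤ S * (S * S) := Nat.mul_le_mul_right _ h3
  have a6 : 16 * (S * (S * S)) ≤ S * (S * (S * S)) := Nat.mul_le_mul_right _ h3
  rw [show S ^ 4 = S * (S * (S * S)) by ring]
  unfold sizeBound
  omega

lemma numCand_le : I.numCand ≤ bitLength I.encode ^ 2 := by
  have h2 := length_le_bitLength I.encode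
  rw [encode_length] at h2
  rw [sq]
  exact Nat.mul_le_mul (by omega) (by omega)

end CarbonInstance

theorem theorem1 :
    Ram.SolvableInPolyTime CarbonInstance.encode CarbonInstance.CorrectAnswer := by
  obtain ⟨P, hP⟩ := CarbonInstance.scheduler.exists_prog CarbonInstance.wellFormed_scheduler
  -- The loop bound is N = L ^ 2 and the word length is B = 4L, so the cost per step is 1 + 2B = 1 +
  -- 8L.
  refine ⟨P, CarbonInstance.scheduler.time.comp (Polynomial.X ^ 2) *
    (1 + Polynomial.C 8 * Polynomial.X), fun I => ?_⟩
  obtain ⟨hsafe, hmem⟩ := CarbonInstance.scheduler_spec I.sizeBound_lt I.numCand_le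
  have hB : ∀ v ∈ I.encode, v < 2 ^ (4 * Ram.bitLength I.encode) := fun v hv =>
    (List.le_sum_of_mem hv).trans_lt ((CarbonInstance.sum_lt_two_pow_bitLength _).trans_le
      (Nat.pow_le_pow_right (by norm_num) (by omega)))
  obtain ⟨s, c, h, hc, hm⟩ := hP _ _ I.encode hB hsafe
  refine ⟨s, c, h, ?_, ?_⟩
  · simp only [Polynomial.eval_mul, Polynomial.eval_comp, Polynomial.eval_add,
      Polynomial.eval_one, Polynomial.eval_C, Polynomial.eval_X, Polynomial.eval_pow]
    exact hc.trans (Nat.mul_le_mul_left _ (by omega))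
  · rw [hm, hmem]
    exact I.correctAnswer_answerMem
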